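/- Let $N\ge 1$ be an integer, $1<p<N$, $s\in(0,1)$, $0\le m<p-1$, $T>0$, and let $\Omega\subset\mathbb R^N$ be a bounded domain with smooth boundary; put $Q_T=(0,T)\times\Omega$ and $d(x)=\operatorname{dist}(x,\partial\Omega)$. Let $\delta,\gamma\in\mathbb R$; if $m>0$, assume that $\delta\in(0,m)$ and that $2\delta-\mathbf d\,\gamma>2m-1$ for some real $\mathbf d>N$. Let $g\in L^2(Q_T)$ and let $u_0\in L^{2(m+1)}(\Omega)$ be nonnegative. Consider the problem $$(E_T)\qquad\begin{cases} u^m\,\partial_t(u^{m+1})-\Delta_p u+(-\Delta)^s_p u=g(t,x)\,u^m+m\,d(x)^{-\gamma}u^{\delta} &\text{in } Q_T,\\ u>0 &\text{in } Q_T,\\ u=0 &\text{on } (0,T)\times(\mathbb R^N\setminus\Omega),\\ u(0,\cdot)=u_0 &\text{in }\Omega.\end{cases}$$ Here $W^{1,p}_0(\Omega)$, with the norm $\|\nabla u\|_{L^p}$, is identified with the space of functions in $W^{1,p}(\mathbb R^N)$ that vanish a.e. outside $\Omega$, and $[a]^{p-1}:=|a|^{p-2}a$. A weak solution of $(E_T)$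 is a function $u\in L^\infty(0,T;W^{1,p}_0(\Omega))\cap L^\infty(Q_T)$ with $u>0$ a.e. in $Q_T$, whose distributional derivative $\partial_t(u^{m+1})$ belongs to $L^2(Q_T)$, with $u(0,\cdot)=u_0$ a.e. in $\Omega$ (that is, the representative of $u^{m+1}$ in $C([0,T];L^2(\Omega))$ equals $u_0^{m+1}$ at $t=0$), and such that for every $t\in(0,T]$ and every $\varphi\in L^2(Q_T)\cap L^1(0,T;W^{1,p}_0(\Omega))$ the following integrals converge absolutely and $$\int_0^t\!\!\int_\Omega u^m\partial_t(u^{m+1})\varphi\,dx\,d\tau+\int_0^t\!\!\int_\Omega|\nabla u|^{p-2}\nabla u\cdot\nabla\varphi\,dx\,d\tau+\int_0^t\!\!\iint_{\mathbb R^{2N}}\frac{[u(\tau,x)-u(\tau,y)]^{p-1}(\varphi(\tau,x)-\varphi(\tau,y))}{|x-y|^{N+sp}}\,dx\,dy\,d\tau=\int_0^t\!\!\int_\Omega\big(g\,u^m+m\,d(x)^{-\gamma}u^\delta\big)\varphi\,dx\,d\tau .$$ If $u$ and $\tilde u$ are weak solutions of $(E_T)$ with the same $u_0$ and the same $g$,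 then $u=\tilde u$ a.e. in $Q_T$. (The condition $p(1-s)<1$ is not assumed.) -/

import Mathlib

open MeasureTheory Set Filter Topology
open scoped ENNReal ContDiff

noncomputable section

/-- Euclidean space `ℝ^N`. -/
abbrev Eucl (N : ℕ) := EuclideanSpace ℝ (Fin N)

/-- `Ω` has a smooth boundary: near each boundary point, `Ω` is the sublevel set `{ρ < 0}` of a
smooth function `ρ` with non-vanishing differential at that point. -/
def HasSmoothBoundary {N : ℕ} (Ω : Set (Eucl N)) : Prop :=
  ∀ x₀ ∈ frontier Ω, ∃ U : Set (Eucl N), IsOpen U ∧ x₀ ∈ U ∧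
    ∃ ρ : Eucl N → ℝ, ContDiffOn ℝ ∞ ρ U ∧ fderiv ℝ ρ x₀ ≠ 0 ∧ ∀ x ∈ U, (x ∈ Ω ↔ ρ x < 0)

/-- A bounded domain (non-empty, open, connected) with smooth boundary. -/
structure IsSmoothBoundedDomain {N : ℕ} (Ω : Set (Eucl N)) : Prop where
  isOpen : IsOpen Ω
  isConnected : IsConnected Ω
  isBounded : Bornology.IsBounded Ω
  smooth_boundary : HasSmoothBoundary Ω

/-- The cylinder `Q_T = (0,T) × Ω`. -/
def cyl {N : ℕ} (T : ℝ) (Ω : Set (Eucl N)) : Set (ℝ × Eucl N) := Ioo 0 T ×ˢ Ω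

/-- The distance `d(x) = dist(x, ∂Ω)`. -/
def bdist {N : ℕ} (Ω : Set (Eucl N)) (x : Eucl N) : ℝ := Metric.infDist x (frontier Ω)

/-- `G` is the weak gradient of `u` on `ℝ^N`. -/
def HasWeakGrad {N : ℕ} (u : Eucl N → ℝ) (G : Eucl N → Eucl N) : Prop :=
  LocallyIntegrable u ∧ LocallyIntegrable G ∧
    ∀ ψ : Eucl N → ℝ, ContDiff ℝ ∞ ψ → HasCompactSupport ψ → ∀ e : Eucl N,
      ∫ x, u x * fderiv ℝ ψ x e = - ∫ x, inner ℝ (G x) e * ψ x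

/-- `u` belongs to `W₀^{1,p}(Ω)`, with weak gradient `G`. As usual for nonlocal problems, a function
in `W₀^{1,p}(Ω)` is identified with its extension by zero: it is a function in `W^{1,p}(ℝ^N)` that
vanishes a.e. outside `Ω`. -/
structure MemW0 {N : ℕ} (p : ℝ) (Ω : Set (Eucl N)) (u : Eucl N → ℝ) (G : Eucl N → Eucl N) :
    Prop where
  memLp : MemLp u (ENNReal.ofReal p)
  memLp_grad : MemLp G (ENNReal.ofReal p)
  hasWeakGrad : HasWeakGrad u G
  eq_zero : ∀ᵐ x, x ∉ Ω → u x = 0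

/-- `u` belongs to the Bochner space `L^q(0,T; W₀^{1,p}(Ω))`, with spatial weak gradient `G`. The
norm on `W₀^{1,p}(Ω)` is `‖∇u‖_{L^p}`; as this space is separable and reflexive, Bochner
measurability of `t ↦ u(t)` amounts to joint measurability. -/
structure MemBochnerW0 {N : ℕ} (q : ℝ≥0∞) (p T : ℝ) (Ω : Set (Eucl N))
    (u : ℝ → Eucl N → ℝ) (G : ℝ → Eucl N → Eucl N) : Prop where
  meas : AEStronglyMeasurable (fun z : ℝ × Eucl N => u z.1 z.2) (volume.restrict (cyl T univ))
  meas_grad :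
    AEStronglyMeasurable (fun z : ℝ × Eucl N => G z.1 z.2) (volume.restrict (cyl T univ))
  slice : ∀ᵐ t ∂(volume.restrict (Ioo 0 T)), MemW0 p Ω (u t) (G t)
  norm_lt_top :
    eLpNorm (fun t => eLpNorm (G t) (ENNReal.ofReal p) volume) q (volume.restrict (Ioo 0 T)) < (⊤ : ℝ≥0∞)

/-- `w` is the distributional time derivative `∂ₜ v` in `Q_T`. -/
def HasWeakTimeDeriv {N : ℕ} (T : ℝ) (Ω : Set (Eucl N)) (v w : ℝ → Eucl N → ℝ) : Prop :=
  ∀ ψ : ℝ × Eucl N → ℝ, ContDiff ℝ ∞ ψ → HasCompactSupport ψ → tsupport ψ ⊆ cyl T Ω →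
    ∫ z in cyl T Ω, v z.1 z.2 * fderiv ℝ ψ z (1, 0) = - ∫ z in cyl T Ω, w z.1 z.2 * ψ z

/-- `v(0,·) = v₀`, in the sense that `v(t) → v₀` in `L²(Ω)` as `t → 0⁺` outside a null set of times.
For `v, ∂ₜ v ∈ L²(Q_T)` this says that the representative of `v` in `C([0,T]; L²(Ω))` takes the
value `v₀` at time `0`. -/
def HasInitialValue {N : ℕ} (Ω : Set (Eucl N)) (v : ℝ → Eucl N → ℝ) (v₀ : Eucl N → ℝ) : Prop :=
  Tendsto (fun t => eLpNorm (fun x => v t x - v₀ x) 2 (volume.restrict Ω))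
    (𝓝[>] (0 : ℝ) ⊓ ae volume) (𝓝 0)

/-- Integrand of `∫∫ u^m ∂ₜ(u^{m+1}) φ`, with `w` in the place of `∂ₜ(u^{m+1})`. -/
def timeTerm {N : ℕ} (m : ℝ) (u w φ : ℝ → Eucl N → ℝ) (z : ℝ × Eucl N) : ℝ :=
  u z.1 z.2 ^ m * w z.1 z.2 * φ z.1 z.2

/-- Integrand of `∫∫ |∇u|^{p-2} ∇u · ∇φ`, with `G` and `H` in the place of `∇u` and `∇φ`. -/
def localTerm {N : ℕ} (p : ℝ) (G H : ℝ → Eucl N → Eucl N) (z : ℝ × Eucl N) : ℝ :=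
  ‖G z.1 z.2‖ ^ (p - 2) * inner ℝ (G z.1 z.2) (H z.1 z.2)

/-- Integrand, at `(t,(x,y))`, of the fractional `p`-Laplacian part
`∫∫∫ [u(x)-u(y)]^{p-1} (φ(x)-φ(y)) / |x-y|^{N+sp}`, where `[a]^{p-1} = |a|^{p-2} a`. -/
def nonlocalTerm {N : ℕ} (p s : ℝ) (u φ : ℝ → Eucl N → ℝ) (z : ℝ × (Eucl N × Eucl N)) : ℝ :=
  |u z.1 z.2.1 - u z.1 z.2.2| ^ (p - 2) * (u z.1 z.2.1 - u z.1 z.2.2) *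
    (φ z.1 z.2.1 - φ z.1 z.2.2) / ‖z.2.1 - z.2.2‖ ^ ((N : ℝ) + s * p)

/-- Integrand of `∫∫ (g u^m + m d^{-γ} u^δ) φ`. -/
def sourceTerm {N : ℕ} (m δ γ : ℝ) (Ω : Set (Eucl N)) (g u φ : ℝ → Eucl N → ℝ)
    (z : ℝ × Eucl N) : ℝ :=
  (g z.1 z.2 * u z.1 z.2 ^ m + m * bdist Ω z.2 ^ (-γ) * u z.1 z.2 ^ δ) * φ z.1 z.2

/-- `u` is a weak solution of
`u^m ∂ₜ(u^{m+1}) - Δ_p u + (-Δ)^s_p u = g u^m + m d^{-γ} u^δ` and `u > 0` in `Q_T`,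
`u = 0` on `(0,T) × (ℝ^N ∖ Ω)`, `u(0,·) = u₀` in `Ω`.
Here `G` is the weak gradient `∇u` and `w` is `∂ₜ(u^{m+1})`; both are determined by `u` a.e. -/
def IsWeakSolution {N : ℕ} (p s m δ γ T : ℝ) (Ω : Set (Eucl N)) (g : ℝ → Eucl N → ℝ)
    (u₀ : Eucl N → ℝ) (u : ℝ → Eucl N → ℝ) : Prop :=
  ∃ (G : ℝ → Eucl N → Eucl N) (w : ℝ → Eucl N → ℝ),
    MemBochnerW0 (⊤ : ℝ≥0∞) p T Ω u G ∧
    MemLp (fun z : ℝ × Eucl N => u z.1 z.2) (⊤ : ℝ≥0∞) (volume.restrict (cyl T Ω)) ∧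
    (∀ᵐ z ∂(volume.restrict (cyl T Ω)), 0 < u z.1 z.2) ∧
    MemLp (fun z : ℝ × Eucl N => w z.1 z.2) 2 (volume.restrict (cyl T Ω)) ∧
    HasWeakTimeDeriv T Ω (fun t x => u t x ^ (m + 1)) w ∧
    HasInitialValue Ω (fun t x => u t x ^ (m + 1)) (fun x => u₀ x ^ (m + 1)) ∧
    ∀ (φ : ℝ → Eucl N → ℝ) (H : ℝ → Eucl N → Eucl N),
      MemLp (fun z : ℝ × Eucl N => φ z.1 z.2) 2 (volume.restrict (cyl T Ω)) →
      MemBochnerW0 1 p T Ω φ H →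
      -- the integrals in the identity converge absolutely
      IntegrableOn (timeTerm m u w φ) (cyl T Ω) ∧
      IntegrableOn (localTerm p G H) (cyl T Ω) ∧
      IntegrableOn (nonlocalTerm p s u φ) (Ioo 0 T ×ˢ univ) ∧
      IntegrableOn (sourceTerm m δ γ Ω g u φ) (cyl T Ω) ∧
      ∀ t ∈ Ioc 0 T,
        (∫ z in cyl t Ω, timeTerm m u w φ z) + (∫ z in cyl t Ω, localTerm p G H z)
          + (∫ z in Ioo 0 t ×ˢ univ, nonlocalTerm p s u φ z)
          = ∫ z in cyl t Ω, sourceTerm m δ γ Ω g u φ z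

end

/-! Put r = m + 1. The proof is of Díaz–Saa type: the equation for u is tested with (u^r -
v^r)/u^(r-1), the equation for v with (v^r - u^r)/v^(r-1), and the two identities are added. By
Picone's inequality, in its gradient form (`picone_inner`) and its discrete form
(`picone_discrete`), the local and nonlocal parts of the sum are each nonnegative; this needs r ≤ p.
The g-terms cancel, the singular terms add up to m d^(-γ) (u^(δ-m) - v^(δ-m)) (u^r - v^r) ≤ 0, and
the time terms become the integral of ∂ₜV · V with V = u^r - v^r. Hence that integral over (0,t) × Ω
is nonpositive for every t.

Since V has zero initial value, V(t) is the time integral of ∂ₜV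
(`HasWeakTimeDeriv.ae_eq_primitive`), so the same integral equals half the square of the L² norm of
V(t). Thus V = 0 and u = v.

The quotients need not be admissible, because u and v vanish at the boundary. They are replaced by
`quotientTest`, where u + ε and v + ε enter; this is a smooth function of (u, v) on a square [0,M]²
and vanishes at the origin, so a chain rule for weak gradients (`HasWeakGrad.comp₂`) makes it a test
function. Picone's inequalities hold for each ε > 0. As ε → 0 the time terms and the g-terms are
dominated by multiples of the time derivatives and of g (`abs_rpow_mul_quotientTest_le`). The
singular terms have only a majorant from above (`quotientTest_le`), integrable because u and v are
themselves admissible test functions; as their limit has the good sign, controlling the positive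
part suffices (`integral_weakTimeDeriv_mul_le_zero`). -/

/-! ### Pointwise inequalities of Young and Picone type -/

theorem Real.young_rpow_sub_one_mul {r x y : ℝ} (hr : 1 ≤ r) (hx : 0 ≤ x) (hy : 0 ≤ y) :
    r * x ^ (r - 1) * y ≤ (r - 1) * x ^ r + y ^ r := by
  have h0 : r ≠ 0 := by positivity
  -- Weighted AM–GM, rather than Young's inequality with conjugate exponents, includes r = 1, where
  -- the first weight is zero.
  have h := Real.geom_mean_le_arith_mean2_weighted (w₁ := (r - 1) / r) (w₂ := 1 / r)
    (p₁ := x ^ r) (p₂ := y ^ r) (div_nonneg (by linarith) (by linarith)) (by positivity)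
    (by positivity) (by positivity) (by field_simp; ring)
  rw [← Real.rpow_mul hx, ← Real.rpow_mul hy, mul_div_cancel₀ _ h0, mul_one_div_cancel h0,
    Real.rpow_one] at h
  have := mul_le_mul_of_nonneg_left h (by linarith : 0 ≤ r)
  have e : r * ((r - 1) / r * x ^ r + 1 / r * y ^ r) = (r - 1) * x ^ r + y ^ r := by field_simp
  linarith

/-- Right side minus left side is (P^(p-r) - Q^(p-r)) (P^r - Q^r), and both factors have the sign of
P - Q. This absorbs the two Picone remainders after symmetrization; it is where m + 1 ≤ p enters. -/
theorem Real.rpow_sub_mul_rpow_add_le {p r P Q : ℝ} (hr : 0 ≤ r) (hrp : r ≤ p)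
    (hp : 0 < p) (hP : 0 ≤ P) (hQ : 0 ≤ Q) :
    P ^ (p - r) * Q ^ r + Q ^ (p - r) * P ^ r ≤ P ^ p + Q ^ p := by
  have e : ∀ X : ℝ, 0 ≤ X → X ^ p = X ^ (p - r) * X ^ r := fun X hX => by
    rw [← Real.rpow_add' hX (by simpa using hp.ne')]; simp
  rw [e P hP, e Q hQ]
  rcases le_total P Q with h | h
  · have h1 := Real.rpow_le_rpow hP h hr
    have h2 := Real.rpow_le_rpow hP h (sub_nonneg.2 hrp)
    nlinarith
  · have h1 := Real.rpow_le_rpow hQ h hr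
    have h2 := Real.rpow_le_rpow hQ h (sub_nonneg.2 hrp)
    nlinarith

/-- The local Picone inequality, for `∇(a - b^r a^{1-r})` with `∇a = A` and `∇b = B`. -/
theorem picone_inner {E : Type*} [NormedAddCommGroup E] [InnerProductSpace ℝ E] {p r a b : ℝ}
    (hp : 1 < p) (hr : 1 ≤ r) (ha : 0 < a) (hb : 0 < b) (A B : E) :
    ‖A‖ ^ p - ‖A‖ ^ (p - r) * ‖B‖ ^ r ≤ ‖A‖ ^ (p - 2) *
      inner ℝ A ((1 + (r - 1) * (b ^ r * a ^ (-r))) • A - (r * (b ^ (r - 1) * a ^ (1 - r))) • B) := by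
  rw [inner_sub_right, inner_smul_right, inner_smul_right, real_inner_self_eq_norm_sq]
  set α := ‖A‖ with hα
  set β := ‖B‖
  have hα0 : 0 ≤ α := norm_nonneg _
  have hβ0 : 0 ≤ β := norm_nonneg _
  -- The exponents p - 2, p - r and r - 1 are combined below by `Real.rpow_add`, which needs a
  -- positive base.
  rcases hα0.eq_or_lt with h0 | hpos
  · have hA : A = 0 := by simpa [hα, eq_comm] using h0
    rw [← h0, hA, Real.zero_rpow (by linarith)]
    simp only [inner_zero_left]
    have := mul_nonneg (Real.rpow_nonneg (le_refl (0:ℝ)) (p - r)) (Real.rpow_nonneg hβ0 r)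
    simp; linarith
  have hAB : inner ℝ A B ≤ α * β := real_inner_le_norm A B
  -- Both coefficients depend on b/a alone. Cauchy–Schwarz bounds the mixed term, and Young's
  -- inequality for tα and β absorbs it.
  set t := b / a with ht
  have ht0 : 0 < t := div_pos hb ha
  have e1 : b ^ r * a ^ (-r) = t ^ r := by
    rw [ht, Real.div_rpow hb.le ha.le, Real.rpow_neg ha.le]; rfl
  have e2 : b ^ (r - 1) * a ^ (1 - r) = t ^ (r - 1) := by
    rw [ht, Real.div_rpow hb.le ha.le, ← neg_sub r 1, Real.rpow_neg ha.le]; rfl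
  rw [e1, e2]
  have hy := Real.young_rpow_sub_one_mul hr (x := t * α) (y := β) (by positivity) hβ0
  rw [Real.mul_rpow ht0.le hα0, Real.mul_rpow ht0.le hα0] at hy
  have q1 : α ^ (p - 2) * α ^ 2 = α ^ p := by
    rw [← Real.rpow_natCast, ← Real.rpow_add hpos]; congr 1; push_cast; ring
  have q2 : α ^ (p - 2) * α = α ^ (p - r) * α ^ (r - 1) := by
    rw [← Real.rpow_add hpos, ← Real.rpow_add_one hpos.ne']; congr 1; ring
  have q3 : α ^ p = α ^ (p - r) * α ^ r := by
    rw [← Real.rpow_add hpos]; congr 1; ring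
  have hc : 0 ≤ α ^ (p - 2) * (r * t ^ (r - 1)) := by positivity
  have s1 := mul_le_mul_of_nonneg_left hAB hc
  have s2 := mul_le_mul_of_nonneg_left hy (by positivity : 0 ≤ α ^ (p - r))
  have s3 : α ^ (p - 2) * (r * t ^ (r - 1)) * (α * β) =
      α ^ (p - r) * (r * (t ^ (r - 1) * α ^ (r - 1)) * β) := by
    calc _ = (α ^ (p - 2) * α) * (r * t ^ (r - 1)) * β := by ring
      _ = _ := by rw [q2]; ring
  have s4 : α ^ (p - 2) * ((1 + (r - 1) * t ^ r) * α ^ 2) = α ^ p + (r-1) * t^r * α ^ p := by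
    rw [← q1]; ring
  have s5 : α ^ (p - r) * ((r - 1) * (t ^ r * α ^ r) + β ^ r) =
      (r - 1) * t ^ r * α ^ p + α ^ (p - r) * β ^ r := by rw [q3]; ring
  rw [mul_sub, s4]
  linarith

/-- Subadditivity of the perspective function `(b, a) ↦ b^r a^{1-r}`. -/
theorem Real.perspective_rpow_add_le {r a b c d : ℝ} (hr : 1 ≤ r) (ha : 0 < a) (hd : 0 < d)
    (hb : 0 ≤ b) (hc : 0 ≤ c) :
    (b + c) ^ r * (a + d) ^ (1 - r) ≤ b ^ r * a ^ (1 - r) + c ^ r * d ^ (1 - r) := by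
  have had : 0 < a + d := by positivity
  -- Jensen at b/a and c/d with weights a/(a+d) and d/(a+d): the mean of the two points is
  -- (b+c)/(a+d).
  have h := (convexOn_rpow hr).2 (mem_Ici.2 (by positivity : 0 ≤ b / a))
    (mem_Ici.2 (by positivity : 0 ≤ c / d)) (by positivity : 0 ≤ a / (a + d))
    (by positivity : 0 ≤ d / (a + d)) (by field_simp)
  simp only [smul_eq_mul] at h
  have e : a / (a + d) * (b / a) + d / (a + d) * (c / d) = (b + c) / (a + d) := by field_simp
  have k : ∀ x y : ℝ, 0 ≤ x → 0 < y → y * (x / y) ^ r = x ^ r * y ^ (1 - r) := fun x y hx hy => by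
    rw [Real.div_rpow hx hy.le, Real.rpow_sub hy, Real.rpow_one]; field_simp
  rw [e] at h
  have h2 := mul_le_mul_of_nonneg_left h had.le
  rw [k _ _ (by positivity) had] at h2
  rw [← k b a hb ha, ← k c d hc hd]
  refine h2.trans (le_of_eq ?_)
  field_simp

/-- Write a₁ = a₂ + (a₁ - a₂) and b₁ ≤ b₂ + |b₁ - b₂|. Subadditivity of the perspective function
then bounds the bracket by |b₁ - b₂|^r (a₁ - a₂)^(1-r). -/
theorem picone_discrete_aux {p r a₁ a₂ b₁ b₂ : ℝ} (hr : 1 ≤ r)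
    (ha₂ : 0 < a₂) (hb₁ : 0 ≤ b₁) (hb₂ : 0 ≤ b₂) (h : a₂ < a₁) :
    (a₁ - a₂) ^ (p - 1) * (b₁ ^ r * a₁ ^ (1 - r) - b₂ ^ r * a₂ ^ (1 - r)) ≤
      (a₁ - a₂) ^ (p - r) * |b₁ - b₂| ^ r := by
  have hd : 0 < a₁ - a₂ := by linarith
  have h1 := Real.perspective_rpow_add_le hr ha₂ hd hb₂ (abs_nonneg (b₁ - b₂))
  rw [add_sub_cancel] at h1
  have h2 : b₁ ^ r ≤ (b₂ + |b₁ - b₂|) ^ r :=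
    Real.rpow_le_rpow hb₁ (by linarith [le_abs_self (b₁ - b₂)]) (by linarith)
  have h3 := mul_le_mul_of_nonneg_right h2 (Real.rpow_nonneg (by linarith : 0 ≤ a₁) (1 - r))
  have h4 : b₁ ^ r * a₁ ^ (1 - r) - b₂ ^ r * a₂ ^ (1 - r) ≤ |b₁ - b₂| ^ r * (a₁ - a₂) ^ (1 - r) := by
    linarith
  refine (mul_le_mul_of_nonneg_left h4 (by positivity)).trans (le_of_eq ?_)
  have : (a₁ - a₂) ^ (p - r) = (a₁ - a₂) ^ (p - 1) * (a₁ - a₂) ^ (1 - r) := by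
    rw [← Real.rpow_add hd]; congr 1; ring
  rw [this]; ring

/-- The discrete Picone inequality. -/
theorem picone_discrete {p r a₁ a₂ b₁ b₂ : ℝ} (hr : 1 ≤ r) (ha₁ : 0 < a₁)
    (ha₂ : 0 < a₂) (hb₁ : 0 ≤ b₁) (hb₂ : 0 ≤ b₂) :
    |a₁ - a₂| ^ (p - 2) * (a₁ - a₂) * (b₁ ^ r * a₁ ^ (1 - r) - b₂ ^ r * a₂ ^ (1 - r)) ≤
      |a₁ - a₂| ^ (p - r) * |b₁ - b₂| ^ r := by
  have key : ∀ d : ℝ, 0 < d → d ^ (p - 2) * d = d ^ (p - 1) := fun d hd => by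
    rw [← Real.rpow_add_one hd.ne']; congr 1; ring
  rcases lt_trichotomy a₁ a₂ with h | h | h
  -- Exchanging the indices changes the sign of both factors on the left.
  · have h1 := picone_discrete_aux (p := p) hr ha₁ hb₂ hb₁ h
    rw [abs_sub_comm a₁, abs_sub_comm b₁, abs_of_pos (by linarith : 0 < a₂ - a₁)]
    rw [← key _ (by linarith : 0 < a₂ - a₁)] at h1
    refine le_trans (le_of_eq ?_) h1
    ring
  · subst h
    simp only [sub_self, mul_zero, zero_mul]
    positivity
  · have h1 := picone_discrete_aux (p := p) hr ha₂ hb₁ hb₂ h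
    rw [abs_of_pos (by linarith : 0 < a₁ - a₂)]
    rwa [← key _ (by linarith : 0 < a₁ - a₂)] at h1

/-! ### Dominated convergence with varying majorants -/

/-- Generalized dominated convergence: the dominating functions may vary, provided that their
integrals converge. -/
theorem tendsto_integral_of_tendsto_dominating {α : Type*} [MeasurableSpace α] {μ : Measure α}
    {f k : ℕ → α → ℝ} {f₀ k₀ : α → ℝ} (hf : ∀ n, AEStronglyMeasurable (f n) μ)
    (hk : ∀ n, Integrable (k n) μ) (hk₀ : Integrable k₀ μ)
    (hfk : ∀ n, ∀ᵐ x ∂μ, |f n x| ≤ k n x)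
    (hfl : ∀ᵐ x ∂μ, Tendsto (fun n => f n x) atTop (𝓝 (f₀ x)))
    (hkl : ∀ᵐ x ∂μ, Tendsto (fun n => k n x) atTop (𝓝 (k₀ x)))
    (hint : Tendsto (fun n => ∫ x, k n x ∂μ) atTop (𝓝 (∫ x, k₀ x ∂μ))) :
    Tendsto (fun n => ∫ x, f n x ∂μ) atTop (𝓝 (∫ x, f₀ x ∂μ)) := by
  have hfk' : ∀ᵐ x ∂μ, ∀ n, |f n x| ≤ k n x := ae_all_iff.2 hfk
  have hlim : ∀ᵐ x ∂μ, |f₀ x| ≤ k₀ x := by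
    filter_upwards [hfk', hfl, hkl] with x h1 h2 h3
    exact le_of_tendsto_of_tendsto' h2.abs h3 h1
  have hfi : ∀ n, Integrable (f n) μ := fun n => (hk n).mono' (hf n) (hfk n)
  have hmin : ∀ n, Integrable (fun x => min (k n x) (k₀ x)) μ := fun n => (hk n).inf hk₀
  -- Truncating f n to [-k₀, k₀] gives a sequence with the fixed majorant k₀. The truncation error
  -- is at most k n - min (k n) k₀, whose integral tends to zero.
  have hclip : ∀ n, AEStronglyMeasurable (fun x => max (-k₀ x) (min (f n x) (k₀ x))) μ := fun n =>
    hk₀.aestronglyMeasurable.neg.sup ((hf n).inf hk₀.aestronglyMeasurable)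
  have hcb : ∀ n, ∀ᵐ x ∂μ, ‖max (-k₀ x) (min (f n x) (k₀ x))‖ ≤ k₀ x := fun n => by
    filter_upwards [hlim] with x hx
    have h0 : 0 ≤ k₀ x := (abs_nonneg _).trans hx
    rw [Real.norm_eq_abs, abs_le]
    exact ⟨le_max_left _ _, max_le (by linarith) (min_le_right _ _)⟩
  have hci : ∀ n, Integrable (fun x => max (-k₀ x) (min (f n x) (k₀ x))) μ := fun n =>
    hk₀.mono' (hclip n) (hcb n)
  have h1 : Tendsto (fun n => ∫ x, min (k n x) (k₀ x) ∂μ) atTop (𝓝 (∫ x, k₀ x ∂μ)) := by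
    refine tendsto_integral_of_dominated_convergence k₀ (fun n => (hmin n).aestronglyMeasurable)
      hk₀ (fun n => ?_) ?_
    · filter_upwards [hlim, hfk n] with x hx hy
      have h0 : 0 ≤ k₀ x := (abs_nonneg _).trans hx
      have h1 : 0 ≤ k n x := (abs_nonneg _).trans hy
      rw [Real.norm_of_nonneg (le_min h1 h0)]
      exact min_le_right _ _
    · filter_upwards [hkl] with x hx
      simpa using hx.min (tendsto_const_nhds (x := k₀ x))
  have h2 : Tendsto (fun n => ∫ x, max (-k₀ x) (min (f n x) (k₀ x)) ∂μ) atTop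
      (𝓝 (∫ x, f₀ x ∂μ)) := by
    refine tendsto_integral_of_dominated_convergence k₀ hclip hk₀ hcb ?_
    filter_upwards [hlim, hfl] with x hx hy
    have := (tendsto_const_nhds (x := -k₀ x)).max (hy.min (tendsto_const_nhds (x := k₀ x)))
    rwa [min_eq_left (abs_le.1 hx).2, max_eq_right (abs_le.1 hx).1] at this
  have h3 : Tendsto (fun n => ∫ x, (f n x - max (-k₀ x) (min (f n x) (k₀ x))) ∂μ) atTop (𝓝 0) := by
    refine squeeze_zero_norm (a := fun n => ∫ x, (k n x - min (k n x) (k₀ x)) ∂μ) (fun n => ?_) ?_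
    · refine norm_integral_le_of_norm_le ((hk n).sub (hmin n)) ?_
      filter_upwards [hlim, hfk n] with x hx hy
      have h0 : 0 ≤ k₀ x := (abs_nonneg _).trans hx
      obtain ⟨a1, a2⟩ := abs_le.1 hy
      rw [Real.norm_eq_abs]
      grind
    · simp_rw [integral_sub (hk _) (hmin _)]
      simpa using hint.sub h1
  simp_rw [integral_sub (hfi _) (hci _)] at h3
  simpa using h3.add h2

/-! ### Mollification and weak gradients -/

section Mollification

open scoped Convolution

variable {N : ℕ} {F : Type*} [NormedAddCommGroup F] [NormedSpace ℝ F]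

noncomputable section

/-- Bump functions with radii tending to zero. -/
def shrinkingBump (N n : ℕ) : ContDiffBump (0 : Eucl N) where
  rIn := 1 / (n + 1)
  rOut := 2 / (n + 1)
  rIn_pos := by positivity
  rIn_lt_rOut := by gcongr; norm_num

/-- Mollification of a function on `ℝ^N`. -/
def mollify (n : ℕ) (f : Eucl N → F) : Eucl N → F :=
  (shrinkingBump N n).normed volume ⋆[ContinuousLinearMap.lsmul ℝ ℝ, volume] f

end

theorem mollify_apply (n : ℕ) (f : Eucl N → F) (x : Eucl N) :
    mollify n f x = ∫ t, (shrinkingBump N n).normed volume t • f (x - t) := rfl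

theorem ae_tendsto_mollify [CompleteSpace F] {f : Eucl N → F} (hf : LocallyIntegrable f) :
    ∀ᵐ x, Tendsto (fun n => mollify n f x) atTop (𝓝 (f x)) := by
  -- The ratio of outer to inner radius is constantly 2; a bounded ratio is what gives convergence
  -- almost everywhere for locally integrable functions.
  refine ContDiffBump.ae_convolution_tendsto_right_of_locallyIntegrable (K := 2) ?_ ?_ hf
  · have := (tendsto_one_div_add_atTop_nhds_zero_nat (𝕜 := ℝ)).const_mul 2
    simpa [shrinkingBump, div_eq_mul_inv] using this
  · refine Eventually.of_forall fun n => le_of_eq ?_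
    simp [shrinkingBump, div_eq_mul_inv]

theorem continuous_mollify {f : Eucl N → F} (hf : LocallyIntegrable f) (n : ℕ) :
    Continuous (mollify n f) :=
  ((shrinkingBump N n).hasCompactSupport_normed (μ := volume)).continuous_convolution_left
    (ContinuousLinearMap.lsmul ℝ ℝ)
    ((shrinkingBump N n).continuous_normed (μ := volume)) hf

theorem integrable_mollify {f : Eucl N → F} (hf : Integrable f) (n : ℕ) :
    Integrable (mollify n f) :=
  ((shrinkingBump N n).integrable_normed (μ := volume)).integrable_convolution
    (ContinuousLinearMap.lsmul ℝ ℝ) hf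

theorem integral_mollify {f : Eucl N → ℝ} (hf : Integrable f) (n : ℕ) :
    ∫ x, mollify n f x = ∫ x, f x := by
  have := integral_convolution (ContinuousLinearMap.lsmul ℝ ℝ) (μ := (volume : Measure (Eucl N)))
    ((shrinkingBump N n).integrable_normed (μ := volume)) hf
  rw [(shrinkingBump N n).integral_normed] at this
  simpa [mollify] using this

theorem norm_mollify_le (f : Eucl N → F) (n : ℕ) (x : Eucl N) :
    ‖mollify n f x‖ ≤ mollify n (fun y => ‖f y‖) x := by
  rw [mollify_apply, mollify_apply]
  refine (norm_integral_le_integral_norm _).trans (le_of_eq ?_)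
  congr 1
  ext t
  rw [norm_smul, Real.norm_of_nonneg ((shrinkingBump N n).nonneg_normed t), smul_eq_mul]

theorem integrable_mollify_integrand {f : Eucl N → F} (hf : LocallyIntegrable f) (n : ℕ)
    (x : Eucl N) : Integrable fun t => (shrinkingBump N n).normed volume t • f (x - t) :=
  ((shrinkingBump N n).hasCompactSupport_normed (μ := volume)).convolutionExists_left
    (ContinuousLinearMap.lsmul ℝ ℝ) (shrinkingBump N n).continuous_normed hf x

/-- A mollification is an average against a probability density. Consequently mollified functions
stay in the square on which the outer function of the chain rule is controlled. -/
theorem mollify_mem_Icc {f : Eucl N → ℝ} (hf : LocallyIntegrable f) {a b : ℝ}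
    (h : ∀ᵐ x, f x ∈ Icc a b) (n : ℕ) (x : Eucl N) : mollify n f x ∈ Icc a b := by
  have hi := integrable_mollify_integrand hf n x
  have hb := (shrinkingBump N n).integrable_normed (μ := volume)
  have h' : ∀ᵐ t, f (x - t) ∈ Icc a b :=
    (quasiMeasurePreserving_sub_left volume x).ae h
  have e : ∀ c : ℝ, ∫ t, (shrinkingBump N n).normed volume t • c = c := fun c => by
    rw [integral_smul_const, (shrinkingBump N n).integral_normed, one_smul]
  rw [mollify_apply]
  constructor
  · rw [← e a]
    refine integral_mono_ae (hb.smul_const a) hi ?_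
    filter_upwards [h'] with t ht
    exact smul_le_smul_of_nonneg_left ht.1 ((shrinkingBump N n).nonneg_normed t)
  · rw [← e b]
    refine integral_mono_ae hi (hb.smul_const b) ?_
    filter_upwards [h'] with t ht
    exact smul_le_smul_of_nonneg_left ht.2 ((shrinkingBump N n).nonneg_normed t)

/-- The derivative falls on the kernel f, and the weak gradient identity is applied to y ↦ f (x -
y). The sign from this reflection cancels the sign in the identity. -/
theorem HasWeakGrad.hasFDerivAt_mollify {u : Eucl N → ℝ} {G : Eucl N → Eucl N}
    (h : HasWeakGrad u G) (n : ℕ) (x : Eucl N) :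
    HasFDerivAt (mollify n u) (innerSL ℝ (mollify n G x)) x := by
  obtain ⟨hu, hG, hw⟩ := h
  set f := (shrinkingBump N n).normed (volume : Measure (Eucl N)) with hf
  have hfc : ContDiff ℝ ∞ f := (shrinkingBump N n).contDiff_normed
  have hfs : HasCompactSupport f := (shrinkingBump N n).hasCompactSupport_normed
  have h1 := hfs.hasFDerivAt_convolution_left (ContinuousLinearMap.lsmul ℝ ℝ)
    (hfc.of_le (by simp)) hu x
  refine h1.congr_fderiv ?_
  ext e
  have hex : Integrable fun t => ((ContinuousLinearMap.lsmul ℝ ℝ).precompL (Eucl N))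
      (fderiv ℝ f t) (u (x - t)) :=
    (hfs.fderiv ℝ).convolutionExists_left _ (hfc.continuous_fderiv (by simp)) hu x
  rw [convolution_def, ContinuousLinearMap.integral_apply hex]
  simp only [ContinuousLinearMap.precompL_apply, ContinuousLinearMap.lsmul_apply, smul_eq_mul,
    innerSL_apply_apply]
  rw [mollify_apply, real_inner_comm, ← integral_inner (integrable_mollify_integrand hG n x)]
  simp_rw [inner_smul_right]
  have hψ : ContDiff ℝ ∞ fun y => f (x - y) := hfc.comp (contDiff_const.sub contDiff_id)
  have hψs : HasCompactSupport fun y => f (x - y) :=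
    hfs.comp_homeomorph (Homeomorph.subLeft x)
  have key := hw _ hψ hψs e
  have hd : ∀ y, fderiv ℝ (fun y => f (x - y)) y e = - fderiv ℝ f (x - y) e := fun y => by
    have := ((hfc.differentiable (by simp)) (x - y)).hasFDerivAt.comp y
      ((hasFDerivAt_const x y).sub (hasFDerivAt_id y))
    have := this.fderiv
    rw [show (fun y => f (x - y)) = f ∘ (fun y => x - y) from rfl]
    erw [this]
    simp
  simp_rw [hd, mul_neg, integral_neg] at key
  rw [neg_inj] at key
  have k1 := integral_sub_left_eq_self (fun t => fderiv ℝ f t e * u (x - t)) volume x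
  have k2 := integral_sub_left_eq_self (fun t => f t * inner ℝ e (G (x - t))) volume x
  rw [← k1, ← k2]
  simp only [sub_sub_cancel]
  simp_rw [mul_comm (fderiv ℝ f _ e), key, mul_comm (f _), real_inner_comm]

end Mollification

/-! ### Chain rule for weak gradients -/

section ChainRule

variable {N : ℕ} {u v : Eucl N → ℝ} {M : ℝ} {Φ : ℝ × ℝ → ℝ}

theorem continuous_comp_mollify (hu : LocallyIntegrable u) (hv : LocallyIntegrable v)
    (hu0 : ∀ᵐ x, u x ∈ Icc 0 M) (hv0 : ∀ᵐ x, v x ∈ Icc 0 M)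
    (hΦ : ContinuousOn Φ (Icc 0 M ×ˢ Icc 0 M)) (n : ℕ) :
    Continuous fun x => Φ (mollify n u x, mollify n v x) :=
  hΦ.comp_continuous ((continuous_mollify hu n).prodMk (continuous_mollify hv n)) fun x =>
    ⟨mollify_mem_Icc hu hu0 n x, mollify_mem_Icc hv hv0 n x⟩

theorem ae_tendsto_comp_mollify (hu : LocallyIntegrable u) (hv : LocallyIntegrable v)
    (hu0 : ∀ᵐ x, u x ∈ Icc 0 M) (hv0 : ∀ᵐ x, v x ∈ Icc 0 M)
    (hΦ : ContinuousOn Φ (Icc 0 M ×ˢ Icc 0 M)) :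
    ∀ᵐ x, Tendsto (fun n => Φ (mollify n u x, mollify n v x)) atTop (𝓝 (Φ (u x, v x))) := by
  filter_upwards [hu0, hv0, ae_tendsto_mollify hu, ae_tendsto_mollify hv] with x h1 h2 h3 h4
  exact (hΦ (u x, v x) ⟨h1, h2⟩).tendsto.comp (tendsto_nhdsWithin_iff.2
    ⟨h3.prodMk_nhds h4, Eventually.of_forall fun n =>
      ⟨mollify_mem_Icc hu hu0 n x, mollify_mem_Icc hv hv0 n x⟩⟩)

theorem aestronglyMeasurable_comp_of_mem_Icc (hu : LocallyIntegrable u) (hv : LocallyIntegrable v)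
    (hu0 : ∀ᵐ x, u x ∈ Icc 0 M) (hv0 : ∀ᵐ x, v x ∈ Icc 0 M)
    (hΦ : ContinuousOn Φ (Icc 0 M ×ˢ Icc 0 M)) :
    AEStronglyMeasurable (fun x => Φ (u x, v x)) volume :=
  aestronglyMeasurable_of_tendsto_ae atTop
    (fun n => (continuous_comp_mollify hu hv hu0 hv0 hΦ n).aestronglyMeasurable)
    (ae_tendsto_comp_mollify hu hv hu0 hv0 hΦ)

theorem exists_abs_le_of_continuousOn (hΦ : ContinuousOn Φ (Icc 0 M ×ˢ Icc 0 M)) :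
    ∃ C, 0 ≤ C ∧ ∀ a ∈ Icc 0 M, ∀ b ∈ Icc 0 M, |Φ (a, b)| ≤ C := by
  obtain ⟨C, hC⟩ := (isCompact_Icc.prod isCompact_Icc).exists_bound_of_continuousOn hΦ
  exact ⟨max C 0, le_max_right _ _, fun a ha b hb =>
    (hC (a, b) ⟨ha, hb⟩).trans (le_max_left _ _)⟩

theorem tendsto_integral_comp_mollify_mul {ψ : Eucl N → ℝ} (hu : LocallyIntegrable u)
    (hv : LocallyIntegrable v)
    (hu0 : ∀ᵐ x, u x ∈ Icc 0 M) (hv0 : ∀ᵐ x, v x ∈ Icc 0 M)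
    (hΦ : ContinuousOn Φ (Icc 0 M ×ˢ Icc 0 M)) (hψ : Integrable ψ) :
    Tendsto (fun n => ∫ x, Φ (mollify n u x, mollify n v x) * ψ x) atTop
      (𝓝 (∫ x, Φ (u x, v x) * ψ x)) := by
  obtain ⟨C, hC0, hC⟩ := exists_abs_le_of_continuousOn hΦ
  refine tendsto_integral_of_dominated_convergence (fun x => C * ‖ψ x‖) (fun n =>
    (continuous_comp_mollify hu hv hu0 hv0 hΦ n).aestronglyMeasurable.mul
      hψ.aestronglyMeasurable) (hψ.norm.const_mul C) (fun n => ?_) ?_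
  · refine Eventually.of_forall fun x => ?_
    rw [norm_mul]
    exact mul_le_mul_of_nonneg_right (hC _ (mollify_mem_Icc hu hu0 n x) _
      (mollify_mem_Icc hv hv0 n x)) (norm_nonneg _)
  · filter_upwards [ae_tendsto_comp_mollify hu hv hu0 hv0 hΦ] with x hx
    exact hx.mul_const _

/-- The natural majorant, a multiple of the mollification of ‖G‖, varies with n, but its integral
does not; hence the generalized dominated convergence theorem. -/
theorem tendsto_integral_comp_mollify_mul_inner {ψ : Eucl N → ℝ} {G : Eucl N → Eucl N}
    (hu : LocallyIntegrable u) (hv : LocallyIntegrable v)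
    (hu0 : ∀ᵐ x, u x ∈ Icc 0 M) (hv0 : ∀ᵐ x, v x ∈ Icc 0 M)
    (hΦ : ContinuousOn Φ (Icc 0 M ×ˢ Icc 0 M)) (hG : Integrable G) (hψ : Continuous ψ)
    (hψs : HasCompactSupport ψ) (e : Eucl N) :
    Tendsto (fun n => ∫ x, Φ (mollify n u x, mollify n v x) * inner ℝ (mollify n G x) e * ψ x)
      atTop (𝓝 (∫ x, Φ (u x, v x) * inner ℝ (G x) e * ψ x)) := by
  obtain ⟨C, hC0, hC⟩ := exists_abs_le_of_continuousOn hΦ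
  obtain ⟨D, hD⟩ := hψs.exists_bound_of_continuous hψ
  have hGn := hG.norm
  refine tendsto_integral_of_tendsto_dominating
    (k := fun n x => C * D * ‖e‖ * mollify n (fun y => ‖G y‖) x)
    (k₀ := fun x => C * D * ‖e‖ * ‖G x‖) (fun n => ?_)
    (fun n => (integrable_mollify hGn n).const_mul _) (hGn.const_mul _) (fun n => ?_) ?_ ?_ ?_
  · exact (((continuous_comp_mollify hu hv hu0 hv0 hΦ n).mul
      ((continuous_mollify hG.locallyIntegrable n).inner continuous_const)).mul
      hψ).aestronglyMeasurable
  · refine Eventually.of_forall fun x => ?_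
    have h1 := hC _ (mollify_mem_Icc hu hu0 n x) _ (mollify_mem_Icc hv hv0 n x)
    have h2 : |inner ℝ (mollify n G x) e| ≤ mollify n (fun y => ‖G y‖) x * ‖e‖ :=
      (abs_real_inner_le_norm _ _).trans
        (mul_le_mul_of_nonneg_right (norm_mollify_le G n x) (norm_nonneg _))
    have h3 : |ψ x| ≤ D := hD x
    have h0 : 0 ≤ mollify n (fun y => ‖G y‖) x := (norm_nonneg _).trans (norm_mollify_le G n x)
    rw [abs_mul, abs_mul]
    calc _ ≤ C * (mollify n (fun y => ‖G y‖) x * ‖e‖) * D := by gcongr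
      _ = _ := by ring
  · filter_upwards [ae_tendsto_comp_mollify hu hv hu0 hv0 hΦ,
      ae_tendsto_mollify hG.locallyIntegrable] with x h1 h2
    exact (h1.mul (h2.inner tendsto_const_nhds)).mul_const _
  · filter_upwards [ae_tendsto_mollify hGn.locallyIntegrable] with x h1
    exact h1.const_mul _
  · simp_rw [integral_const_mul, integral_mollify hGn]
    exact tendsto_const_nhds

theorem integrable_comp_smul_of_mem_Icc {G : Eucl N → Eucl N} (hu : LocallyIntegrable u)
    (hv : LocallyIntegrable v)
    (hu0 : ∀ᵐ x, u x ∈ Icc 0 M) (hv0 : ∀ᵐ x, v x ∈ Icc 0 M)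
    (hΦ : ContinuousOn Φ (Icc 0 M ×ˢ Icc 0 M)) (hG : Integrable G) :
    Integrable fun x => Φ (u x, v x) • G x := by
  obtain ⟨C, hC0, hC⟩ := exists_abs_le_of_continuousOn hΦ
  refine (hG.norm.const_mul C).mono'
    ((aestronglyMeasurable_comp_of_mem_Icc hu hv hu0 hv0 hΦ).smul hG.aestronglyMeasurable) ?_
  filter_upwards [hu0, hv0] with x h1 h2
  rw [norm_smul]
  exact mul_le_mul_of_nonneg_right (hC _ h1 _ h2) (norm_nonneg _)

/-- The chain rule for weak gradients of bounded functions. -/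
theorem HasWeakGrad.comp₂ {G K : Eucl N → Eucl N} {Φ Φ₁ Φ₂ : ℝ × ℝ → ℝ}
    (hu : HasWeakGrad u G) (hv : HasWeakGrad v K)
    (hG : Integrable G) (hK : Integrable K)
    (hu0 : ∀ᵐ x, u x ∈ Icc 0 M) (hv0 : ∀ᵐ x, v x ∈ Icc 0 M)
    (hΦ : ∀ z ∈ Icc 0 M ×ˢ Icc 0 M, HasFDerivAt Φ
      (Φ₁ z • ContinuousLinearMap.fst ℝ ℝ ℝ + Φ₂ z • ContinuousLinearMap.snd ℝ ℝ ℝ) z)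
    (hΦ₁ : ContinuousOn Φ₁ (Icc 0 M ×ˢ Icc 0 M)) (hΦ₂ : ContinuousOn Φ₂ (Icc 0 M ×ˢ Icc 0 M)) :
    HasWeakGrad (fun x => Φ (u x, v x))
      (fun x => Φ₁ (u x, v x) • G x + Φ₂ (u x, v x) • K x) := by
  have hΦc : ContinuousOn Φ (Icc 0 M ×ˢ Icc 0 M) := fun z hz =>
    (hΦ z hz).continuousAt.continuousWithinAt
  have hi₁ := integrable_comp_smul_of_mem_Icc hu.1 hv.1 hu0 hv0 hΦ₁ hG
  have hi₂ := integrable_comp_smul_of_mem_Icc hu.1 hv.1 hu0 hv0 hΦ₂ hK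
  refine ⟨?_, (hi₁.add hi₂).locallyIntegrable, fun ψ hψ hψs e => ?_⟩
  · obtain ⟨C, hC0, hC⟩ := exists_abs_le_of_continuousOn hΦc
    refine (locallyIntegrable_const C).mono
      (aestronglyMeasurable_comp_of_mem_Icc hu.1 hv.1 hu0 hv0 hΦc) ?_
    filter_upwards [hu0, hv0] with x h1 h2
    rw [Real.norm_of_nonneg hC0]
    exact hC _ h1 _ h2
  have hψ' : Continuous fun x => fderiv ℝ ψ x e :=
    (hψ.continuous_fderiv (by simp)).clm_apply continuous_const
  have hψ's : HasCompactSupport fun x => fderiv ℝ ψ x e := hψs.fderiv_apply (𝕜 := ℝ) e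
  have L := tendsto_integral_comp_mollify_mul hu.1 hv.1 hu0 hv0 hΦc
    (hψ'.integrable_of_hasCompactSupport hψ's)
  have R₁ := tendsto_integral_comp_mollify_mul_inner hu.1 hv.1 hu0 hv0 hΦ₁ hG hψ.continuous hψs e
  have R₂ := tendsto_integral_comp_mollify_mul_inner hu.1 hv.1 hu0 hv0 hΦ₂ hK hψ.continuous hψs e
  refine tendsto_nhds_unique L ?_
  have c₁ : ∀ n, Continuous fun x =>
      Φ₁ (mollify n u x, mollify n v x) * inner ℝ (mollify n G x) e * ψ x := fun n =>
    ((continuous_comp_mollify hu.1 hv.1 hu0 hv0 hΦ₁ n).mul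
      ((continuous_mollify hG.locallyIntegrable n).inner continuous_const)).mul hψ.continuous
  have c₂ : ∀ n, Continuous fun x =>
      Φ₂ (mollify n u x, mollify n v x) * inner ℝ (mollify n K x) e * ψ x := fun n =>
    ((continuous_comp_mollify hu.1 hv.1 hu0 hv0 hΦ₂ n).mul
      ((continuous_mollify hK.locallyIntegrable n).inner continuous_const)).mul hψ.continuous
  have i₁ := fun n => (c₁ n).integrable_of_hasCompactSupport (μ := volume) hψs.mul_left
  have i₂ := fun n => (c₂ n).integrable_of_hasCompactSupport (μ := volume) hψs.mul_left
  have d : ∀ n x, HasFDerivAt (fun x => Φ (mollify n u x, mollify n v x))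
      (Φ₁ (mollify n u x, mollify n v x) • innerSL ℝ (mollify n G x) +
        Φ₂ (mollify n u x, mollify n v x) • innerSL ℝ (mollify n K x)) x := fun n x => by
    have := (hΦ (mollify n u x, mollify n v x) ⟨mollify_mem_Icc hu.1 hu0 n x,
      mollify_mem_Icc hv.1 hv0 n x⟩).comp x
      ((hu.hasFDerivAt_mollify n x).prodMk (hv.hasFDerivAt_mollify n x))
    refine this.congr_fderiv ?_
    ext e
    simp
  -- Classical integration by parts for the mollified functions; the weak identity is its limit.
  have key : ∀ n, ∫ x, Φ (mollify n u x, mollify n v x) * fderiv ℝ ψ x e =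
      -((∫ x, Φ₁ (mollify n u x, mollify n v x) * inner ℝ (mollify n G x) e * ψ x) +
        ∫ x, Φ₂ (mollify n u x, mollify n v x) * inner ℝ (mollify n K x) e * ψ x) := fun n => by
    have e' : ∀ x, fderiv ℝ (fun x => Φ (mollify n u x, mollify n v x)) x e * ψ x =
        Φ₁ (mollify n u x, mollify n v x) * inner ℝ (mollify n G x) e * ψ x +
        Φ₂ (mollify n u x, mollify n v x) * inner ℝ (mollify n K x) e * ψ x := fun x => by
      rw [(d n x).fderiv]
      simp
      ring
    have hc := continuous_comp_mollify hu.1 hv.1 hu0 hv0 hΦc n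
    rw [integral_mul_fderiv_eq_neg_fderiv_mul_of_integrable]
    · simp_rw [e']
      rw [integral_add (i₁ n) (i₂ n)]
    · simp_rw [e']
      exact (i₁ n).add (i₂ n)
    · exact (hc.mul hψ').integrable_of_hasCompactSupport hψ's.mul_left
    · exact (hc.mul hψ.continuous).integrable_of_hasCompactSupport hψs.mul_left
    · exact fun x _ => (d n x).differentiableAt
    · exact fun x _ => hψ.differentiable (by simp) x
  have R := (R₁.add R₂).neg
  simp_rw [key]
  convert! R using 2
  obtain ⟨D, hD⟩ := hψs.exists_bound_of_continuous hψ.continuous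
  have j : ∀ {X : Eucl N → Eucl N}, Integrable X → Integrable fun x => inner ℝ (X x) e * ψ x :=
    fun hX => (hX.inner_const e).mul_bdd hψ.continuous.aestronglyMeasurable
      (Eventually.of_forall hD)
  have j₁ := j hi₁
  have j₂ := j hi₂
  simp only [inner_smul_left, RCLike.conj_to_real] at j₁ j₂
  rw [← integral_add j₁ j₂]
  congr 2
  ext x
  simp only [inner_add_left, inner_smul_left, RCLike.conj_to_real]
  ring

end ChainRule

/-- Composition with the projection onto the square extends Φ continuously to the plane. -/
theorem aestronglyMeasurable_comp_of_continuousOn {α : Type*} [MeasurableSpace α] {μ : Measure α}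
    {u v : α → ℝ} {M : ℝ} {Φ : ℝ × ℝ → ℝ} (hM : 0 ≤ M) (hu : AEStronglyMeasurable u μ)
    (hv : AEStronglyMeasurable v μ) (hu0 : ∀ᵐ x ∂μ, u x ∈ Icc 0 M) (hv0 : ∀ᵐ x ∂μ, v x ∈ Icc 0 M)
    (hΦ : ContinuousOn Φ (Icc 0 M ×ˢ Icc 0 M)) :
    AEStronglyMeasurable (fun x => Φ (u x, v x)) μ := by
  have hc : Continuous fun z : ℝ × ℝ =>
      Φ ((projIcc 0 M hM z.1 : ℝ), (projIcc 0 M hM z.2 : ℝ)) :=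
    hΦ.comp_continuous (by fun_prop) fun z => ⟨Subtype.property _, Subtype.property _⟩
  refine (hc.comp_aestronglyMeasurable (hu.prodMk hv)).congr ?_
  filter_upwards [hu0, hv0] with x h1 h2
  simp [projIcc_of_mem hM h1, projIcc_of_mem hM h2]

/-! ### Function spaces on the cylinder and their stability under composition -/

section Cylinder

variable {N : ℕ} {p T M : ℝ} {Ω : Set (Eucl N)}

theorem volume_restrict_cyl (T : ℝ) (Ω : Set (Eucl N)) :
    (volume : Measure (ℝ × Eucl N)).restrict (cyl T Ω) =
      (volume.restrict (Ioo 0 T)).prod (volume.restrict Ω) := by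
  rw [cyl, Measure.volume_eq_prod, Measure.prod_restrict]

theorem volume_restrict_cyl_univ (T : ℝ) :
    (volume : Measure (ℝ × Eucl N)).restrict (cyl T univ) =
      (volume.restrict (Ioo 0 T)).prod volume := by
  rw [volume_restrict_cyl, Measure.restrict_univ]

theorem measurableSet_cyl (hΩ : MeasurableSet Ω) (T : ℝ) : MeasurableSet (cyl T Ω) :=
  measurableSet_Ioo.prod hΩ

theorem volume_cyl_lt_top (hΩ : Bornology.IsBounded Ω) (T : ℝ) : volume (cyl T Ω) < ⊤ := by
  rw [cyl, Measure.volume_eq_prod, Measure.prod_prod]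
  exact ENNReal.mul_lt_top measure_Ioo_lt_top hΩ.measure_lt_top

theorem isFiniteMeasure_restrict_cyl (hΩ : Bornology.IsBounded Ω) (T : ℝ) :
    IsFiniteMeasure ((volume : Measure (ℝ × Eucl N)).restrict (cyl T Ω)) :=
  ⟨by rw [Measure.restrict_apply_univ]; exact volume_cyl_lt_top hΩ T⟩

theorem cyl_subset_univ (T : ℝ) (Ω : Set (Eucl N)) : cyl T Ω ⊆ cyl T univ :=
  prod_mono_right (subset_univ _)

theorem cyl_subset_cyl {t : ℝ} (ht : t ≤ T) (Ω : Set (Eucl N)) : cyl t Ω ⊆ cyl T Ω :=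
  prod_mono_left (Ioo_subset_Ioo_right ht)

/-- Testing outside the closure of Ω shows that G vanishes there almost everywhere; on the closure,
which is compact, local integrability suffices. -/
theorem MemW0.integrable_grad {u : Eucl N → ℝ} {G : Eucl N → Eucl N}
    (hΩ : Bornology.IsBounded Ω) (h : MemW0 p Ω u G) : Integrable G := by
  have hz : ∀ᵐ x, x ∈ (closure Ω)ᶜ → G x = 0 := by
    refine isClosed_closure.isOpen_compl.ae_eq_zero_of_integral_contDiff_smul_eq_zero
      (h.hasWeakGrad.2.1.locallyIntegrableOn _) fun ψ hψ hψs hsub => ?_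
    have hi : Integrable fun x => ψ x • G x :=
      h.hasWeakGrad.2.1.integrable_smul_left_of_hasCompactSupport hψ.continuous hψs
    refine ext_inner_right ℝ fun e => ?_
    rw [real_inner_comm, ← integral_inner hi, inner_zero_left]
    have key := h.hasWeakGrad.2.2 ψ hψ hψs e
    have : ∫ x, u x * fderiv ℝ ψ x e = 0 := by
      refine integral_eq_zero_of_ae ?_
      filter_upwards [h.eq_zero] with x hx
      by_cases hxΩ : x ∈ Ω
      · have : fderiv ℝ ψ x = 0 := by
          by_contra hne
          exact hsub (support_fderiv_subset ℝ hne) (subset_closure hxΩ)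
        simp [this]
      · simp [hx hxΩ]
    rw [this, eq_comm, neg_eq_zero] at key
    rw [← key]
    congr 1
    ext x
    rw [inner_smul_right, real_inner_comm, mul_comm]
  have hc : IsCompact (closure Ω) := hΩ.isCompact_closure
  have h1 : IntegrableOn G (closure Ω) :=
    h.hasWeakGrad.2.1.integrableOn_isCompact hc
  refine (integrableOn_iff_integrable_of_support_subset (f := (closure Ω).indicator G)
    support_indicator_subset).1 ((integrableOn_congr_fun (fun x hx => ?_)
      isClosed_closure.measurableSet).1 h1) |>.congr ?_
  · simp [hx]
  · filter_upwards [hz] with x hx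
    by_cases hm : x ∈ closure Ω
    · simp [hm]
    · simp [hm, hx hm]

theorem MemBochnerW0.ae_eq_zero {q : ℝ≥0∞} {u : ℝ → Eucl N → ℝ} {G : ℝ → Eucl N → Eucl N}
    (hΩ : MeasurableSet Ω) (h : MemBochnerW0 q p T Ω u G) :
    ∀ᵐ z ∂(volume.restrict (cyl T (univ : Set (Eucl N)))), z.2 ∉ Ω → u z.1 z.2 = 0 := by
  have hm := h.meas
  rw [volume_restrict_cyl_univ] at hm ⊢
  -- The vanishing is known slice by slice. Fubini turns it into a joint statement only for a
  -- measurable set, hence the measurable representative.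
  have hset : MeasurableSet {z : ℝ × Eucl N | z.2 ∉ Ω → hm.mk _ z = 0} := by
    have h1 : MeasurableSet {z : ℝ × Eucl N | z.2 ∈ Ω} := measurable_snd hΩ
    have h2 : MeasurableSet {z : ℝ × Eucl N | hm.mk _ z = 0} :=
      hm.stronglyMeasurable_mk.measurable (measurableSet_singleton 0)
    convert! h1.union h2 using 1
    ext z
    simp [imp_iff_not_or]
  have hae := hm.ae_eq_mk
  have key : ∀ᵐ z ∂((volume.restrict (Ioo 0 T)).prod (volume : Measure (Eucl N))),
      z.2 ∉ Ω → hm.mk _ z = 0 := by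
    rw [Measure.ae_prod_iff_ae_ae hset]
    filter_upwards [h.slice, Measure.ae_ae_of_ae_prod hae] with t h1 h2
    filter_upwards [h1.eq_zero, h2] with x h3 h4 hx
    rw [← h4]
    exact h3 hx
  filter_upwards [hae, key] with z h1 h2 hz
  rw [h1, h2 hz]

theorem MemBochnerW0.ae_mem_Icc {q : ℝ≥0∞} {u : ℝ → Eucl N → ℝ} {G : ℝ → Eucl N → Eucl N}
    (hΩ : MeasurableSet Ω) (h : MemBochnerW0 q p T Ω u G) (hM : 0 ≤ M)
    (hb : ∀ᵐ z ∂(volume.restrict (cyl T Ω)), u z.1 z.2 ∈ Icc 0 M) :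
    ∀ᵐ z ∂(volume.restrict (cyl T (univ : Set (Eucl N)))), u z.1 z.2 ∈ Icc 0 M := by
  rw [ae_restrict_iff' (measurableSet_cyl hΩ T)] at hb
  have h0 := h.ae_eq_zero hΩ
  rw [ae_restrict_iff' (measurableSet_cyl MeasurableSet.univ T)] at h0 ⊢
  filter_upwards [hb, h0] with z h1 h2 hz
  by_cases hm : z.2 ∈ Ω
  · exact h1 ⟨hz.1, hm⟩
  · rw [h2 hz hm]
    exact ⟨le_rfl, hM⟩

theorem MemW0.comp₂ {u v : Eucl N → ℝ} {G K : Eucl N → Eucl N} {Φ Φ₁ Φ₂ : ℝ × ℝ → ℝ}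
    (hΩ : MeasurableSet Ω) (hΩb : Bornology.IsBounded Ω)
    (hu : MemW0 p Ω u G) (hv : MemW0 p Ω v K)
    (hu0 : ∀ᵐ x, u x ∈ Icc 0 M) (hv0 : ∀ᵐ x, v x ∈ Icc 0 M)
    (hΦ : ∀ z ∈ Icc 0 M ×ˢ Icc 0 M, HasFDerivAt Φ
      (Φ₁ z • ContinuousLinearMap.fst ℝ ℝ ℝ + Φ₂ z • ContinuousLinearMap.snd ℝ ℝ ℝ) z)
    (hΦ₁ : ContinuousOn Φ₁ (Icc 0 M ×ˢ Icc 0 M)) (hΦ₂ : ContinuousOn Φ₂ (Icc 0 M ×ˢ Icc 0 M))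
    (h0 : Φ (0, 0) = 0) :
    MemW0 p Ω (fun x => Φ (u x, v x))
      (fun x => Φ₁ (u x, v x) • G x + Φ₂ (u x, v x) • K x) := by
  have hΦc : ContinuousOn Φ (Icc 0 M ×ˢ Icc 0 M) := fun z hz =>
    (hΦ z hz).continuousAt.continuousWithinAt
  have hlu := hu.hasWeakGrad.1
  have hlv := hv.hasWeakGrad.1
  have hz : ∀ᵐ x, x ∉ Ω → Φ (u x, v x) = 0 := by
    filter_upwards [hu.eq_zero, hv.eq_zero] with x h1 h2 hx
    rw [h1 hx, h2 hx, h0]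
  have hsm : ∀ {Ψ : ℝ × ℝ → ℝ} {X : Eucl N → Eucl N}, ContinuousOn Ψ (Icc 0 M ×ˢ Icc 0 M) →
      MemLp X (ENNReal.ofReal p) → MemLp (fun x => Ψ (u x, v x) • X x) (ENNReal.ofReal p) := by
    intro Ψ X hΨ hX
    obtain ⟨C, hC0, hC⟩ := exists_abs_le_of_continuousOn hΨ
    refine hX.of_le_mul (c := C)
      ((aestronglyMeasurable_comp_of_mem_Icc hlu hlv hu0 hv0 hΨ).smul hX.aestronglyMeasurable) ?_
    filter_upwards [hu0, hv0] with x h1 h2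
    rw [norm_smul]
    exact mul_le_mul_of_nonneg_right (hC _ h1 _ h2) (norm_nonneg _)
  refine ⟨?_, (hsm hΦ₁ hu.memLp_grad).add (hsm hΦ₂ hv.memLp_grad),
    hu.hasWeakGrad.comp₂ hv.hasWeakGrad (hu.integrable_grad hΩb) (hv.integrable_grad hΩb)
      hu0 hv0 hΦ hΦ₁ hΦ₂, hz⟩
  obtain ⟨C, hC0, hC⟩ := exists_abs_le_of_continuousOn hΦc
  have : IsFiniteMeasure (volume.restrict Ω) :=
    ⟨by rw [Measure.restrict_apply_univ]; exact hΩb.measure_lt_top⟩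
  have h1 : MemLp (fun x => Φ (u x, v x)) (ENNReal.ofReal p) (volume.restrict Ω) := by
    refine MemLp.of_bound
      (aestronglyMeasurable_comp_of_mem_Icc hlu hlv hu0 hv0 hΦc).restrict C (ae_restrict_of_ae ?_)
    filter_upwards [hu0, hv0] with x h1 h2
    exact hC _ h1 _ h2
  refine (memLp_congr_ae ?_).1 ((memLp_indicator_iff_restrict hΩ).2 h1)
  filter_upwards [hz] with x hx
  by_cases hm : x ∈ Ω
  · simp [hm]
  · simp [hm, hx hm]

theorem eLpNorm_one_lt_top_of_ae_le_const {f : ℝ → ℝ≥0∞} {C : ℝ≥0∞} (hC : C < ⊤)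
    (h : ∀ᵐ t ∂(volume.restrict (Ioo 0 T)), f t ≤ C) :
    eLpNorm f 1 (volume.restrict (Ioo 0 T)) < ⊤ := by
  rw [eLpNorm_one_eq_lintegral_enorm]
  simp only [enorm_eq_self]
  refine (lintegral_mono_ae h).trans_lt ?_
  rw [lintegral_const, Measure.restrict_apply_univ]
  exact ENNReal.mul_lt_top hC measure_Ioo_lt_top

theorem MemBochnerW0.ae_eLpNorm_grad_le {u : ℝ → Eucl N → ℝ} {G : ℝ → Eucl N → Eucl N}
    (h : MemBochnerW0 ⊤ p T Ω u G) : ∃ C : ℝ≥0∞, C < ⊤ ∧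
      ∀ᵐ t ∂(volume.restrict (Ioo 0 T)), eLpNorm (G t) (ENNReal.ofReal p) ≤ C := by
  refine ⟨_, h.norm_lt_top, ?_⟩
  rw [eLpNorm_exponent_top]
  simpa using ae_le_eLpNormEssSup
    (f := fun t => eLpNorm (G t) (ENNReal.ofReal p) volume) (μ := volume.restrict (Ioo 0 T))

theorem MemBochnerW0.to_one {u : ℝ → Eucl N → ℝ} {G : ℝ → Eucl N → Eucl N}
    (h : MemBochnerW0 ⊤ p T Ω u G) : MemBochnerW0 1 p T Ω u G := by
  obtain ⟨C, hC, h1⟩ := h.ae_eLpNorm_grad_le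
  exact ⟨h.meas, h.meas_grad, h.slice, eLpNorm_one_lt_top_of_ae_le_const hC h1⟩

/-- The partial derivatives of Φ are bounded on the square, so the gradient norms are bounded
uniformly in time, and (0,T) has finite length. Vanishing of Φ at the origin keeps the zero exterior
values. -/
theorem MemBochnerW0.comp₂ {u v : ℝ → Eucl N → ℝ} {G K : ℝ → Eucl N → Eucl N}
    {Φ Φ₁ Φ₂ : ℝ × ℝ → ℝ} (hM : 0 ≤ M)
    (hp : 1 ≤ p) (hΩ : MeasurableSet Ω) (hΩb : Bornology.IsBounded Ω)
    (hu : MemBochnerW0 ⊤ p T Ω u G) (hv : MemBochnerW0 ⊤ p T Ω v K)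
    (hu0 : ∀ᵐ z ∂(volume.restrict (cyl T (univ : Set (Eucl N)))), u z.1 z.2 ∈ Icc 0 M)
    (hv0 : ∀ᵐ z ∂(volume.restrict (cyl T (univ : Set (Eucl N)))), v z.1 z.2 ∈ Icc 0 M)
    (hΦ : ∀ z ∈ Icc 0 M ×ˢ Icc 0 M, HasFDerivAt Φ
      (Φ₁ z • ContinuousLinearMap.fst ℝ ℝ ℝ + Φ₂ z • ContinuousLinearMap.snd ℝ ℝ ℝ) z)
    (hΦ₁ : ContinuousOn Φ₁ (Icc 0 M ×ˢ Icc 0 M)) (hΦ₂ : ContinuousOn Φ₂ (Icc 0 M ×ˢ Icc 0 M))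
    (h0 : Φ (0, 0) = 0) :
    MemBochnerW0 1 p T Ω (fun t x => Φ (u t x, v t x))
      (fun t x => Φ₁ (u t x, v t x) • G t x + Φ₂ (u t x, v t x) • K t x) := by
  have hΦc : ContinuousOn Φ (Icc 0 M ×ˢ Icc 0 M) := fun z hz =>
    (hΦ z hz).continuousAt.continuousWithinAt
  have hus := hu0
  have hvs := hv0
  rw [volume_restrict_cyl_univ] at hus hvs
  have hus := Measure.ae_ae_of_ae_prod hus
  have hvs := Measure.ae_ae_of_ae_prod hvs
  refine ⟨aestronglyMeasurable_comp_of_continuousOn hM hu.meas hv.meas hu0 hv0 hΦc,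
    ((aestronglyMeasurable_comp_of_continuousOn hM hu.meas hv.meas hu0 hv0 hΦ₁).smul
      hu.meas_grad).add ((aestronglyMeasurable_comp_of_continuousOn hM hu.meas hv.meas hu0 hv0
        hΦ₂).smul hv.meas_grad), ?_, ?_⟩
  · filter_upwards [hu.slice, hv.slice, hus, hvs] with t h1 h2 h3 h4
    exact h1.comp₂ hΩ hΩb h2 h3 h4 hΦ hΦ₁ hΦ₂ h0
  obtain ⟨A, hA, hGA⟩ := hu.ae_eLpNorm_grad_le
  obtain ⟨B, hB, hKB⟩ := hv.ae_eLpNorm_grad_le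
  obtain ⟨C, hC0, hC⟩ := exists_abs_le_of_continuousOn hΦ₁
  obtain ⟨D, hD0, hD⟩ := exists_abs_le_of_continuousOn hΦ₂
  refine eLpNorm_one_lt_top_of_ae_le_const
    (C := ENNReal.ofReal C * A + ENNReal.ofReal D * B) ?_ ?_
  · exact ENNReal.add_lt_top.2 ⟨ENNReal.mul_lt_top ENNReal.ofReal_lt_top hA,
      ENNReal.mul_lt_top ENNReal.ofReal_lt_top hB⟩
  filter_upwards [hu.slice, hv.slice, hus, hvs, hGA, hKB] with t h1 h2 h3 h4 h5 h6
  have hlu := h1.hasWeakGrad.1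
  have hlv := h2.hasWeakGrad.1
  refine (eLpNorm_add_le
    ((aestronglyMeasurable_comp_of_mem_Icc hlu hlv h3 h4 hΦ₁).smul
      h1.memLp_grad.aestronglyMeasurable)
    ((aestronglyMeasurable_comp_of_mem_Icc hlu hlv h3 h4 hΦ₂).smul
      h2.memLp_grad.aestronglyMeasurable) (by simpa using hp)).trans (add_le_add ?_ ?_)
  · refine (eLpNorm_le_mul_eLpNorm_of_ae_le_mul ?_ _).trans (mul_le_mul_right h5 _)
    filter_upwards [h3, h4] with x k1 k2
    simp only [Pi.smul_apply', norm_smul]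
    exact mul_le_mul_of_nonneg_right (hC _ k1 _ k2) (norm_nonneg _)
  · refine (eLpNorm_le_mul_eLpNorm_of_ae_le_mul ?_ _).trans (mul_le_mul_right h6 _)
    filter_upwards [h3, h4] with x k1 k2
    simp only [Pi.smul_apply', norm_smul]
    exact mul_le_mul_of_nonneg_right (hD _ k1 _ k2) (norm_nonneg _)

end Cylinder

/-! ### Primitives and cut-offs in time -/

theorem integral_mul_integral_Ioo_swap {T : ℝ} {f g : ℝ → ℝ} (hf : IntegrableOn f (Ioo 0 T))
    (hg : IntegrableOn g (Ioo 0 T)) :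
    ∫ τ in Ioo 0 T, f τ * ∫ t in Ioo τ T, g t =
      ∫ t in Ioo 0 T, (∫ τ in Ioo 0 t, f τ) * g t := by
  have hm : MeasurableSet {z : ℝ × ℝ | z.1 < z.2} := measurableSet_lt measurable_fst measurable_snd
  have hi : Integrable (Function.uncurry fun τ t =>
      {z : ℝ × ℝ | z.1 < z.2}.indicator (fun z => f z.1 * g z.2) (τ, t))
      ((volume.restrict (Ioo 0 T)).prod (volume.restrict (Ioo 0 T))) :=
    (Integrable.mul_prod hf hg).indicator hm
  have h := integral_integral_swap hi
  have e1 : ∀ τ ∈ Ioo 0 T, ∫ t in Ioo 0 T,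
      {z : ℝ × ℝ | z.1 < z.2}.indicator (fun z => f z.1 * g z.2) (τ, t) =
      f τ * ∫ t in Ioo τ T, g t := fun τ hτ => by
    rw [← integral_const_mul]
    have : (fun t => {z : ℝ × ℝ | z.1 < z.2}.indicator (fun z => f z.1 * g z.2) (τ, t)) =
        (Ioi τ).indicator fun t => f τ * g t := by
      ext t; simp [indicator]
    rw [this, setIntegral_indicator measurableSet_Ioi]
    congr 2
    ext t
    simp only [mem_inter_iff, mem_Ioo, mem_Ioi]
    constructor
    · rintro ⟨⟨_, h2⟩, h3⟩; exact ⟨h3, h2⟩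
    · rintro ⟨h1, h2⟩; exact ⟨⟨hτ.1.trans h1, h2⟩, h1⟩
  have e2 : ∀ t ∈ Ioo 0 T, ∫ τ in Ioo 0 T,
      {z : ℝ × ℝ | z.1 < z.2}.indicator (fun z => f z.1 * g z.2) (τ, t) =
      (∫ τ in Ioo 0 t, f τ) * g t := fun t ht => by
    rw [← integral_mul_const]
    have : (fun τ => {z : ℝ × ℝ | z.1 < z.2}.indicator (fun z => f z.1 * g z.2) (τ, t)) =
        (Iio t).indicator fun τ => f τ * g t := by
      ext τ; simp [indicator]
    rw [this, setIntegral_indicator measurableSet_Iio]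
    congr 2
    ext τ
    simp only [mem_inter_iff, mem_Ioo, mem_Iio]
    constructor
    · rintro ⟨⟨h1, _⟩, h3⟩; exact ⟨h1, h3⟩
    · rintro ⟨h1, h2⟩; exact ⟨⟨h1, h2.trans ht.2⟩, h2⟩
  rw [setIntegral_congr_fun measurableSet_Ioo e1, setIntegral_congr_fun measurableSet_Ioo e2] at h
  exact h

/-- With I the left side, Fubini on the triangle τ < t and the splitting of (0,T) at τ give I = (∫
f)² - I. No differentiation of the primitive is needed. -/
theorem integral_mul_primitive_eq_half_sq {T : ℝ} {f : ℝ → ℝ} (hf : IntegrableOn f (Ioo 0 T)) :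
    ∫ t in Ioo 0 T, f t * (∫ τ in Ioo 0 t, f τ) = (∫ τ in Ioo 0 T, f τ) ^ 2 / 2 := by
  have h := integral_mul_integral_Ioo_swap hf hf
  have hsplit : ∀ τ ∈ Ioo 0 T, f τ * ∫ t in Ioo τ T, f t =
      f τ * (∫ t in Ioo 0 T, f t) - f τ * ∫ t in Ioo 0 τ, f t := fun τ hτ => by
    have : ∫ t in Ioo 0 T, f t = (∫ t in Ioo 0 τ, f t) + ∫ t in Ioo τ T, f t := by
      rw [← integral_Ioc_eq_integral_Ioo (x := 0) (y := τ), ← setIntegral_union]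
      · rw [Ioc_union_Ioo_eq_Ioo hτ.1.le hτ.2]
      · exact Set.disjoint_left.2 fun x h1 h2 => (h2.1.trans_le h1.2).false
      · exact measurableSet_Ioo
      · exact hf.mono_set fun x hx => ⟨hx.1, hx.2.trans_lt hτ.2⟩
      · exact hf.mono_set fun x hx => ⟨hτ.1.trans hx.1, hx.2⟩
    rw [this]; ring
  have hprim : IntegrableOn (fun τ => f τ * ∫ t in Ioo 0 τ, f t) (Ioo 0 T) := by
    have hm : AEStronglyMeasurable (fun t => ∫ τ in Ioo 0 t, f τ) (volume.restrict (Ioo 0 T)) := by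
      have hc : ContinuousOn (fun t => ∫ τ in (0 : ℝ)..t, f τ) (Icc 0 T) := by
        by_cases hT : 0 ≤ T
        · have := intervalIntegral.continuousOn_primitive_interval (f := f) (μ := volume)
            (a := 0) (b := T) (by
              rw [uIcc_of_le hT]
              exact (integrableOn_Icc_iff_integrableOn_Ioo).2 hf)
          rwa [uIcc_of_le hT] at this
        · simp [Icc_eq_empty hT]
      refine ((hc.mono Ioo_subset_Icc_self).aestronglyMeasurable measurableSet_Ioo).congr ?_
      filter_upwards [ae_restrict_mem measurableSet_Ioo] with t ht
      rw [intervalIntegral.integral_of_le ht.1.le, integral_Ioc_eq_integral_Ioo]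
    refine Integrable.mul_bdd (c := ∫ τ in Ioo 0 T, ‖f τ‖) hf hm ?_
    filter_upwards [ae_restrict_mem measurableSet_Ioo] with t ht
    exact (norm_integral_le_integral_norm _).trans (setIntegral_mono_set hf.norm
      (Eventually.of_forall fun _ => norm_nonneg _) (Ioo_subset_Ioo_right ht.2.le).eventuallyLE)
  rw [setIntegral_congr_fun measurableSet_Ioo hsplit, integral_sub (hf.mul_const _) hprim,
    integral_mul_const] at h
  simp_rw [mul_comm _ (f _)] at h
  linarith

/-- A compactly supported smooth function on the cylinder has a smooth primitive in time that
vanishes near the final time. -/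
theorem exists_smooth_time_primitive {N : ℕ} {T : ℝ} {Ω : Set (Eucl N)} {ψ : ℝ × Eucl N → ℝ}
    (hT : 0 < T)
    (hψ : ContDiff ℝ ∞ ψ) (hψs : HasCompactSupport ψ) (hsub : tsupport ψ ⊆ cyl T Ω) :
    ∃ Ψ : ℝ × Eucl N → ℝ, ContDiff ℝ ∞ Ψ ∧
      (∀ t x, HasDerivAt (fun s => Ψ (s, x)) (-ψ (t, x)) t) ∧
      (∃ b < T, ∃ K, IsCompact K ∧ K ⊆ Ω ∧ ∀ t x, Ψ (t, x) ≠ 0 → t ≤ b ∧ x ∈ K) ∧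
      ∀ t ∈ Ioo 0 T, ∀ x, Ψ (t, x) = ∫ τ in Ioo t T, ψ (τ, x) := by
  have hcr : ∀ x, Continuous fun t => ψ (t, x) := fun x =>
    hψ.continuous.comp (continuous_id.prodMk continuous_const)
  have hK1 : IsCompact (Prod.fst '' tsupport ψ) := hψs.isCompact.image continuous_fst
  have hK2 : IsCompact (Prod.snd '' tsupport ψ) := hψs.isCompact.image continuous_snd
  have hk1 : ∀ t x, t ∉ Prod.fst '' tsupport ψ → ψ (t, x) = 0 := fun t x h =>
    image_eq_zero_of_notMem_tsupport fun h' => h ⟨_, h', rfl⟩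
  have hk2 : ∀ t x, x ∉ Prod.snd '' tsupport ψ → ψ (t, x) = 0 := fun t x h =>
    image_eq_zero_of_notMem_tsupport fun h' => h ⟨_, h', rfl⟩
  have hz : ∀ t x, t ∉ Ioo 0 T → ψ (t, x) = 0 := fun t x h => hk1 t x fun ⟨z, hz, hzt⟩ =>
    h (hzt ▸ (hsub hz).1)
  obtain ⟨b, hbT, hb⟩ : ∃ b < T, ∀ t ∈ Prod.fst '' tsupport ψ, t ≤ b := by
    by_cases hne : (Prod.fst '' tsupport ψ).Nonempty
    · obtain ⟨b, hb, hmax⟩ := hK1.exists_isMaxOn hne continuousOn_id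
      obtain ⟨z, hz, rfl⟩ := hb
      exact ⟨z.1, (hsub hz).1.2, fun t ht => hmax ht⟩
    · rw [not_nonempty_iff_eq_empty] at hne
      exact ⟨0, hT, by simp [hne]⟩
  have hcs : ∀ x, HasCompactSupport fun t => ψ (t, x) := fun x =>
    HasCompactSupport.intro hK1 fun t ht => hk1 t x ht
  have hint : ∀ x, Integrable fun t => ψ (t, x) := fun x =>
    (hcr x).integrable_of_hasCompactSupport (hcs x)
  -- The integral of ψ over (t, ∞) is the convolution in time with the indicator of (-∞, 0];
  -- smoothness of convolutions with a parameter gives joint smoothness.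
  have hconv : ContDiff ℝ ∞ fun q : Eucl N × ℝ =>
      (convolution ((Iic (0 : ℝ)).indicator fun _ => (1 : ℝ)) (fun t => ψ (t, q.1))
        (ContinuousLinearMap.lsmul ℝ ℝ) volume) q.2 := by
    have := contDiffOn_convolution_right_with_param (𝕜 := ℝ) (μ := (volume : Measure ℝ))
      (f := (Iic (0 : ℝ)).indicator fun _ => (1 : ℝ)) (n := ⊤) (ContinuousLinearMap.lsmul ℝ ℝ)
      (g := fun x t => ψ (t, x)) (s := (univ : Set (Eucl N))) isOpen_univ hK1
      (fun x t _ ht => hk1 t x ht)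
      ((locallyIntegrable_const (1 : ℝ)).indicator measurableSet_Iic)
      (hψ.comp (contDiff_snd.prodMk contDiff_fst)).contDiffOn
    rwa [univ_prod_univ, contDiffOn_univ] at this
  have heq : ∀ t x, (convolution ((Iic (0 : ℝ)).indicator fun _ => (1 : ℝ)) (fun t => ψ (t, x))
      (ContinuousLinearMap.lsmul ℝ ℝ) volume) t = ∫ τ in Ioi t, ψ (τ, x) := fun t x => by
    rw [convolution_def, ← integral_Ici_eq_integral_Ioi, ← integral_indicator measurableSet_Ici,
      ← integral_sub_left_eq_self _ volume t]
    congr 1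
    ext s
    simp [indicator]
  refine ⟨fun z => ∫ τ in Ioi z.1, ψ (τ, z.2), ?_, fun t x => ?_, ⟨b, hbT, _, hK2, ?_, ?_⟩, ?_⟩
  · simp_rw [← heq]
    exact hconv.comp (contDiff_snd.prodMk contDiff_fst)
  · have h1 : (fun s => ∫ τ in Ioi s, ψ (τ, x)) =
        fun s => (∫ τ in Ioi 0, ψ (τ, x)) - ∫ τ in (0 : ℝ)..s, ψ (τ, x) := by
      ext s
      rw [← intervalIntegral.integral_Ioi_sub_Ioi' (hint x).integrableOn (hint x).integrableOn]
      ring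
    simp only [h1]
    exact ((hcr x).integral_hasStrictDerivAt 0 t).hasDerivAt.const_sub _
  · rintro _ ⟨z, hz, rfl⟩
    exact (hsub hz).2
  · intro t x hne
    constructor
    · by_contra! hlt
      refine hne (setIntegral_eq_zero_of_forall_eq_zero fun τ hτ => hk1 τ x fun hm => ?_)
      exact absurd (hb τ hm) (not_le.2 (hlt.trans hτ))
    · by_contra hx
      exact hne (setIntegral_eq_zero_of_forall_eq_zero fun τ _ => hk2 τ x hx)
  · intro t _ x
    refine (setIntegral_eq_of_subset_of_forall_sdiff_eq_zero measurableSet_Ioi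
      (fun s hs => hs.1) fun s hs => hz s x fun h => hs.2 ⟨hs.1, h.2⟩)

theorem Real.smoothTransition.deriv_eq_zero {t : ℝ} (ht : t ∉ Icc (0 : ℝ) 1) :
    deriv Real.smoothTransition t = 0 := by
  rw [mem_Icc, not_and_or, not_le, not_le] at ht
  rcases ht with h | h
  · have : Real.smoothTransition =ᶠ[𝓝 t] fun _ => 0 := by
      filter_upwards [Iio_mem_nhds h] with s hs
      exact Real.smoothTransition.zero_of_nonpos hs.le
    rw [this.deriv_eq, deriv_const]
  · have : Real.smoothTransition =ᶠ[𝓝 t] fun _ => 1 := by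
      filter_upwards [Ioi_mem_nhds h] with s hs
      exact Real.smoothTransition.one_of_one_le hs.le
    rw [this.deriv_eq, deriv_const]

theorem Real.smoothTransition.exists_abs_deriv_le :
    ∃ C, 0 ≤ C ∧ ∀ t, |deriv Real.smoothTransition t| ≤ C := by
  obtain ⟨C, hC⟩ := (isCompact_Icc (a := (0 : ℝ)) (b := 1)).exists_bound_of_continuousOn
    (f := deriv Real.smoothTransition)
    ((Real.smoothTransition.contDiff (n := 1)).continuous_deriv (by simp)).continuousOn
  refine ⟨max C 0, le_max_right _ _, fun t => ?_⟩
  by_cases ht : t ∈ Icc (0 : ℝ) 1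
  · exact (hC t ht).trans (le_max_left _ _)
  · simp [Real.smoothTransition.deriv_eq_zero ht]

/-! ### The weak time derivative tested up to the initial time -/

section TimeDerivative

variable {N : ℕ} {T : ℝ} {Ω : Set (Eucl N)}

theorem tendsto_integral_cutoff_mul {f : ℝ × Eucl N → ℝ} (hΩ : MeasurableSet Ω)
    (hf : IntegrableOn f (cyl T Ω)) :
    Tendsto (fun n : ℕ => ∫ z in cyl T Ω, Real.smoothTransition ((n + 1) * z.1 - 1) * f z) atTop
      (𝓝 (∫ z in cyl T Ω, f z)) := by
  refine tendsto_integral_of_dominated_convergence (fun z => ‖f z‖) (fun n => ?_) hf.norm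
    (fun n => Eventually.of_forall fun z => ?_) ?_
  · exact (Real.smoothTransition.continuous.comp (by fun_prop)).aestronglyMeasurable.mul
      hf.aestronglyMeasurable
  · rw [norm_mul, Real.norm_of_nonneg (Real.smoothTransition.nonneg _)]
    exact mul_le_of_le_one_left (norm_nonneg _) (Real.smoothTransition.le_one _)
  · filter_upwards [ae_restrict_mem (measurableSet_cyl hΩ T)] with z hz
    refine tendsto_const_nhds.congr' ?_
    obtain ⟨n₀, hn₀⟩ := exists_nat_gt (2 / z.1)
    filter_upwards [eventually_ge_atTop n₀] with n hn
    have h0 : 0 < z.1 := hz.1.1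
    have h1 : 2 < n₀ * z.1 := (div_lt_iff₀ h0).1 hn₀
    have h2 : (n₀ : ℝ) ≤ n := by exact_mod_cast hn
    rw [Real.smoothTransition.one_of_one_le (by nlinarith), one_mul]

/-- The derivative of the cut-off is of order n + 1, but only on an interval of length 1/(n+1) close
to t = 0, where the L¹ norm of v(t) is small. -/
theorem tendsto_integral_deriv_cutoff_mul {v : ℝ → Eucl N → ℝ} {Ψ : ℝ × Eucl N → ℝ} {D : ℝ}
    (hv : AEStronglyMeasurable (fun z : ℝ × Eucl N => v z.1 z.2) (volume.restrict (cyl T Ω)))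
    (hinit : ∀ ε > 0, ∃ δ > 0, ∀ᵐ t, t ∈ Ioo 0 δ → ∫⁻ x in Ω, ‖v t x‖ₑ ≤ ENNReal.ofReal ε)
    (hΨ : Continuous Ψ) (hΨD : ∀ t ∈ Ioo 0 T, ∀ x, |Ψ (t, x)| ≤ D) :
    Tendsto (fun n : ℕ => ∫ z in cyl T Ω, v z.1 z.2 *
      ((n + 1) * deriv Real.smoothTransition ((n + 1) * z.1 - 1) * Ψ z)) atTop (𝓝 0) := by
  obtain ⟨C, hC0, hC⟩ := Real.smoothTransition.exists_abs_deriv_le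
  rw [Metric.tendsto_atTop]
  intro e he
  have hD0 : 0 ≤ max D 0 := le_max_right _ _
  have hpos : 0 < C * max D 0 + 1 := by positivity
  -- With this tolerance the total is at most e/2; the summand 1 avoids division by zero.
  obtain ⟨δ, hδ, hδt⟩ := hinit (e / 2 / (C * max D 0 + 1)) (by positivity)
  obtain ⟨n₀, hn₀⟩ := exists_nat_gt (2 / δ)
  refine ⟨n₀, fun n hn => ?_⟩
  have hn1 : (0 : ℝ) < n + 1 := by positivity
  have h2δ : 2 / ((n : ℝ) + 1) < δ := by
    rw [div_lt_iff₀ hn1]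
    have h1 := (div_lt_iff₀ hδ).1 hn₀
    have h2 : (n₀ : ℝ) ≤ n := by exact_mod_cast hn
    nlinarith
  rw [dist_zero_right]
  refine lt_of_le_of_lt ?_ (half_lt_self he)
  refine (norm_integral_le_lintegral_norm _).trans ?_
  refine ENNReal.toReal_le_of_le_ofReal (by positivity) ?_
  simp_rw [ofReal_norm]
  have hst : Continuous (deriv Real.smoothTransition) :=
    (Real.smoothTransition.contDiff (n := 1)).continuous_deriv (by simp)
  have hmeas : AEMeasurable (fun z : ℝ × Eucl N => ‖v z.1 z.2 *
      ((n + 1) * deriv Real.smoothTransition ((n + 1) * z.1 - 1) * Ψ z)‖ₑ)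
      ((volume.restrict (Ioo 0 T)).prod (volume.restrict Ω)) := by
    rw [volume_restrict_cyl] at hv
    exact (hv.mul ((continuous_const.mul (hst.comp (by fun_prop))).mul
      hΨ).aestronglyMeasurable).enorm
  rw [volume_restrict_cyl, lintegral_prod _ hmeas]
  have hbound : ∀ᵐ t ∂(volume.restrict (Ioo 0 T)), ∫⁻ x in Ω, ‖v t x *
      ((n + 1) * deriv Real.smoothTransition ((n + 1) * t - 1) * Ψ (t, x))‖ₑ ≤
      (Icc (1 / ((n : ℝ) + 1)) (2 / ((n : ℝ) + 1))).indicator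
        (fun _ => ENNReal.ofReal ((n + 1) * C * max D 0) *
          ENNReal.ofReal (e / 2 / (C * max D 0 + 1))) t := by
    filter_upwards [ae_restrict_of_ae hδt, ae_restrict_mem measurableSet_Ioo] with t h1 h2
    by_cases ht : t ∈ Icc (1 / ((n : ℝ) + 1)) (2 / ((n : ℝ) + 1))
    · rw [indicator_of_mem ht]
      have h3 : ∀ x, ‖v t x * ((n + 1) * deriv Real.smoothTransition ((n + 1) * t - 1) *
          Ψ (t, x))‖ₑ ≤ ENNReal.ofReal ((n + 1) * C * max D 0) * ‖v t x‖ₑ := fun x => by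
        rw [enorm_mul, mul_comm]
        gcongr
        rw [Real.enorm_eq_ofReal_abs]
        refine ENNReal.ofReal_le_ofReal ?_
        rw [abs_mul, abs_mul, abs_of_pos hn1]
        have a1 := hC ((n + 1) * t - 1)
        have a2 := (hΨD t h2 x).trans (le_max_left D 0)
        gcongr
      refine (lintegral_mono h3).trans ?_
      rw [lintegral_const_mul' _ _ ENNReal.ofReal_ne_top]
      gcongr
      exact h1 ⟨h2.1, ht.2.trans_lt h2δ⟩
    · rw [indicator_of_notMem ht]
      have : deriv Real.smoothTransition ((n + 1) * t - 1) = 0 := by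
        refine Real.smoothTransition.deriv_eq_zero fun h => ht ⟨?_, ?_⟩
        · rw [div_le_iff₀ hn1]; linarith [h.1]
        · rw [le_div_iff₀ hn1]; linarith [h.2]
      simp [this]
  refine (lintegral_mono_ae hbound).trans ((setLIntegral_le_lintegral _ _).trans ?_)
  rw [lintegral_indicator measurableSet_Icc, lintegral_const, Measure.restrict_apply_univ,
    Real.volume_Icc, ← ENNReal.ofReal_mul (by positivity), ← ENNReal.ofReal_mul (by positivity)]
  refine ENNReal.ofReal_le_ofReal ?_
  have : ((n : ℝ) + 1) * C * max D 0 * (e / 2 / (C * max D 0 + 1)) *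
      (2 / ((n : ℝ) + 1) - 1 / ((n : ℝ) + 1)) =
      C * max D 0 / (C * max D 0 + 1) * (e / 2) := by field_simp; ring
  rw [this]
  refine mul_le_of_le_one_left (by positivity) ?_
  rw [div_le_one hpos]
  linarith

/-- Ψ need not vanish near t = 0, so it is first multiplied by a cut-off in time. The term
containing the derivative of the cut-off disappears in the limit because v has zero initial value.
-/
theorem HasWeakTimeDeriv.integral_mul_eq {v w : ℝ → Eucl N → ℝ} {ψ Ψ : ℝ × Eucl N → ℝ} {b : ℝ}
    {K : Set (Eucl N)} (h : HasWeakTimeDeriv T Ω v w) (hΩ : MeasurableSet Ω)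
    (hv : IntegrableOn (fun z : ℝ × Eucl N => v z.1 z.2) (cyl T Ω))
    (hw : IntegrableOn (fun z : ℝ × Eucl N => w z.1 z.2) (cyl T Ω))
    (hinit : ∀ ε > 0, ∃ δ > 0, ∀ᵐ t, t ∈ Ioo 0 δ → ∫⁻ x in Ω, ‖v t x‖ₑ ≤ ENNReal.ofReal ε)
    (hψ : Continuous ψ) (hψs : HasCompactSupport ψ) (hΨ : ContDiff ℝ ∞ Ψ)
    (hd : ∀ t x, HasDerivAt (fun s => Ψ (s, x)) (-ψ (t, x)) t) (hb : b < T) (hK : IsCompact K)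
    (hKΩ : K ⊆ Ω) (hΨK : ∀ t x, Ψ (t, x) ≠ 0 → t ≤ b ∧ x ∈ K) :
    ∫ z in cyl T Ω, v z.1 z.2 * ψ z = ∫ z in cyl T Ω, w z.1 z.2 * Ψ z := by
  obtain ⟨D, hD⟩ := ((isCompact_Icc (a := 0) (b := T)).prod hK).exists_bound_of_continuousOn
    hΨ.continuous.continuousOn
  have hΨD : ∀ t ∈ Ioo 0 T, ∀ x, |Ψ (t, x)| ≤ max D 0 := fun t ht x => by
    by_cases hx : x ∈ K
    · exact (hD (t, x) ⟨Ioo_subset_Icc_self ht, hx⟩).trans (le_max_left _ _)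
    · have : Ψ (t, x) = 0 := by
        by_contra hne
        exact hx (hΨK t x hne).2
      simp [this]
  obtain ⟨E, hE⟩ := hψs.exists_bound_of_continuous hψ
  have hvψ : IntegrableOn (fun z : ℝ × Eucl N => v z.1 z.2 * ψ z) (cyl T Ω) :=
    Integrable.mul_bdd hv hψ.aestronglyMeasurable (Eventually.of_forall hE)
  have hwΨ : IntegrableOn (fun z : ℝ × Eucl N => w z.1 z.2 * Ψ z) (cyl T Ω) := by
    refine Integrable.mul_bdd (c := max D 0) hw hΨ.continuous.aestronglyMeasurable ?_
    filter_upwards [ae_restrict_mem (measurableSet_cyl hΩ T)] with z hz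
    exact hΨD z.1 hz.1 z.2
  have lA := tendsto_integral_deriv_cutoff_mul hv.aestronglyMeasurable hinit hΨ.continuous hΨD
  have lB := tendsto_integral_cutoff_mul hΩ hvψ
  have lC := tendsto_integral_cutoff_mul hΩ hwΨ
  have hst : Continuous (deriv Real.smoothTransition) :=
    (Real.smoothTransition.contDiff (n := 1)).continuous_deriv (by simp)
  have key : ∀ n : ℕ, (∫ z in cyl T Ω, v z.1 z.2 *
      ((n + 1) * deriv Real.smoothTransition ((n + 1) * z.1 - 1) * Ψ z)) -
      (∫ z in cyl T Ω, Real.smoothTransition ((n + 1) * z.1 - 1) * (v z.1 z.2 * ψ z)) =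
      -∫ z in cyl T Ω, Real.smoothTransition ((n + 1) * z.1 - 1) * (w z.1 z.2 * Ψ z) := by
    intro n
    have hn1 : (0 : ℝ) < n + 1 := by positivity
    have hθ : ContDiff ℝ ∞ fun z : ℝ × Eucl N =>
        Real.smoothTransition ((n + 1) * z.1 - 1) * Ψ z :=
      (Real.smoothTransition.contDiff.comp (by fun_prop)).mul hΨ
    have hsupp : ∀ z : ℝ × Eucl N, z ∉ Icc (1 / ((n : ℝ) + 1)) b ×ˢ K →
        Real.smoothTransition ((n + 1) * z.1 - 1) * Ψ z = 0 := fun z hz => by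
      by_contra hne
      obtain ⟨h1, h2⟩ := hΨK z.1 z.2 (right_ne_zero_of_mul hne)
      refine hz ⟨⟨?_, h1⟩, h2⟩
      by_contra! hlt
      refine left_ne_zero_of_mul hne (Real.smoothTransition.zero_of_nonpos ?_)
      rw [lt_div_iff₀ hn1] at hlt
      linarith
    have hcomp : IsCompact (Icc (1 / ((n : ℝ) + 1)) b ×ˢ K) := isCompact_Icc.prod hK
    have hsub : tsupport (fun z : ℝ × Eucl N =>
        Real.smoothTransition ((n + 1) * z.1 - 1) * Ψ z) ⊆ cyl T Ω := by
      refine (closure_minimal (fun z hz => ?_) hcomp.isClosed).trans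
        (prod_mono (fun s hs => ⟨lt_of_lt_of_le (by positivity) hs.1, hs.2.trans_lt hb⟩) hKΩ)
      by_contra hz'
      exact hz (hsupp z hz')
    have hid := h _ hθ (HasCompactSupport.intro hcomp fun z hz => hsupp z hz) hsub
    have hder : ∀ z : ℝ × Eucl N, fderiv ℝ (fun z : ℝ × Eucl N =>
        Real.smoothTransition ((n + 1) * z.1 - 1) * Ψ z) z (1, 0) =
        (n + 1) * deriv Real.smoothTransition ((n + 1) * z.1 - 1) * Ψ z -
          Real.smoothTransition ((n + 1) * z.1 - 1) * ψ z := fun z => by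
      have hl : HasDerivAt (fun s : ℝ => (s, z.2)) (1, 0) z.1 :=
        (hasDerivAt_id z.1).prodMk (hasDerivAt_const _ _)
      have h1 := ((hθ.differentiable (by simp)) z).hasFDerivAt.comp_hasDerivAt z.1 hl
      have h2 : HasDerivAt (fun s : ℝ => Real.smoothTransition ((n + 1) * s - 1))
          (deriv Real.smoothTransition ((n + 1) * z.1 - 1) * (n + 1)) z.1 := by
        have h3 : HasDerivAt (fun s : ℝ => (n + 1) * s - 1) ((n : ℝ) + 1) z.1 := by
          simpa using ((hasDerivAt_id z.1).const_mul ((n : ℝ) + 1)).sub_const 1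
        exact (((Real.smoothTransition.contDiff (n := 1)).differentiable (by simp))
          _).hasDerivAt.comp z.1 h3
      have h4 := h1.unique (h2.mul (hd z.1 z.2))
      rw [h4]
      ring
    simp_rw [hder] at hid
    have i1 : IntegrableOn (fun z : ℝ × Eucl N => v z.1 z.2 *
        ((n + 1) * deriv Real.smoothTransition ((n + 1) * z.1 - 1) * Ψ z)) (cyl T Ω) := by
      obtain ⟨C, hC0, hC⟩ := Real.smoothTransition.exists_abs_deriv_le
      refine Integrable.mul_bdd (c := (n + 1) * C * max D 0) hv
        ((continuous_const.mul (hst.comp (by fun_prop))).mul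
          hΨ.continuous).aestronglyMeasurable ?_
      filter_upwards [ae_restrict_mem (measurableSet_cyl hΩ T)] with z hz
      rw [norm_mul, norm_mul, Real.norm_of_nonneg hn1.le]
      have a1 := hC ((n + 1) * z.1 - 1)
      have a2 := hΨD z.1 hz.1 z.2
      rw [← Real.norm_eq_abs] at a1 a2
      gcongr
    have i2 : IntegrableOn (fun z : ℝ × Eucl N =>
        Real.smoothTransition ((n + 1) * z.1 - 1) * (v z.1 z.2 * ψ z)) (cyl T Ω) := by
      refine Integrable.bdd_mul (c := 1) hvψ
        (Real.smoothTransition.continuous.comp (by fun_prop)).aestronglyMeasurable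
        (Eventually.of_forall fun z => ?_)
      rw [Real.norm_of_nonneg (Real.smoothTransition.nonneg _)]
      exact Real.smoothTransition.le_one _
    rw [← integral_sub i1 i2]
    convert hid using 2
    · ext z; ring
    · congr 1; ext z; ring
  have := tendsto_nhds_unique (lC.neg.congr fun n => (key n).symm) (lA.sub lB)
  linarith

end TimeDerivative

/-! ### Representation by the time primitive, and the energy argument -/

section TimePrimitive

variable {N : ℕ} {T : ℝ} {Ω : Set (Eucl N)}

theorem integrableOn_time_primitive {w : ℝ → Eucl N → ℝ}
    (hw : IntegrableOn (fun z : ℝ × Eucl N => w z.1 z.2) (cyl T Ω)) :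
    IntegrableOn (fun z : ℝ × Eucl N => ∫ τ in Ioo 0 z.1, w τ z.2) (cyl T Ω) := by
  rw [IntegrableOn, volume_restrict_cyl] at hw ⊢
  have hg : Integrable (fun x => ∫ τ in Ioo 0 T, ‖w τ x‖) (volume.restrict Ω) :=
    hw.integral_norm_prod_right
  have hm : AEStronglyMeasurable
      (fun z : ℝ × Eucl N => ∫ τ in Ioo 0 T, (Ioi τ).indicator (fun _ => w τ z.2) z.1)
      ((volume.restrict (Ioo 0 T)).prod (volume.restrict Ω)) := by
    have hq : Measure.QuasiMeasurePreserving (fun a : (ℝ × Eucl N) × ℝ => (a.2, a.1.2))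
        (((volume.restrict (Ioo 0 T)).prod (volume.restrict Ω)).prod (volume.restrict (Ioo 0 T)))
        ((volume.restrict (Ioo 0 T)).prod (volume.restrict Ω)) :=
      (Measure.measurePreserving_swap.quasiMeasurePreserving).comp
        (QuasiMeasurePreserving.prodMap Measure.quasiMeasurePreserving_snd
          (Measure.QuasiMeasurePreserving.id _))
    have h1 := hw.aestronglyMeasurable.comp_quasiMeasurePreserving hq
    have h2 : MeasurableSet {a : (ℝ × Eucl N) × ℝ | a.2 < a.1.1} :=
      measurableSet_lt measurable_snd measurable_fst.fst
    have h3 := (h1.indicator h2).integral_prod_right'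
    refine h3.congr (Eventually.of_forall fun z => ?_)
    refine integral_congr_ae (Eventually.of_forall fun τ => ?_)
    simp [indicator]
  have he : ∀ z : ℝ × Eucl N, z.1 ∈ Ioo 0 T → ∫ τ in Ioo 0 T,
      (Ioi τ).indicator (fun _ => w τ z.2) z.1 = ∫ τ in Ioo 0 z.1, w τ z.2 := fun z hz => by
    have : (fun τ => (Ioi τ).indicator (fun _ => w τ z.2) z.1) =
        (Iio z.1).indicator fun τ => w τ z.2 := by
      ext τ; simp [indicator]
    rw [this, setIntegral_indicator measurableSet_Iio]
    congr 2
    ext τ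
    simp only [mem_inter_iff, mem_Ioo, mem_Iio]
    exact ⟨fun ⟨⟨h1, _⟩, h3⟩ => ⟨h1, h3⟩, fun ⟨h1, h2⟩ => ⟨⟨h1, h2.trans hz.2⟩, h2⟩⟩
  have hmem : ∀ᵐ z ∂((volume.restrict (Ioo 0 T)).prod (volume.restrict Ω)), z.1 ∈ Ioo 0 T :=
    Measure.quasiMeasurePreserving_fst.ae (ae_restrict_mem measurableSet_Ioo)
  refine (hg.comp_snd (volume.restrict (Ioo 0 T))).mono' (hm.congr ?_) ?_
  · filter_upwards [hmem] with z hz using he z hz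
  · filter_upwards [hmem, Measure.quasiMeasurePreserving_snd.ae hw.prod_left_ae] with z hz h1
    exact (norm_integral_le_integral_norm _).trans (setIntegral_mono_set h1.norm
      (Eventually.of_forall fun _ => norm_nonneg _) (Ioo_subset_Ioo_right hz.2.le).eventuallyLE)

/-- Testing with the backward primitive Ψ of ψ and using Fubini in time, v and the primitive of w
have the same integral against every ψ. -/
theorem HasWeakTimeDeriv.ae_eq_primitive {v w : ℝ → Eucl N → ℝ} (hT : 0 < T)
    (h : HasWeakTimeDeriv T Ω v w) (hΩ : IsOpen Ω)
    (hv : IntegrableOn (fun z : ℝ × Eucl N => v z.1 z.2) (cyl T Ω))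
    (hw : IntegrableOn (fun z : ℝ × Eucl N => w z.1 z.2) (cyl T Ω))
    (hinit : ∀ ε > 0, ∃ δ > 0, ∀ᵐ t, t ∈ Ioo 0 δ → ∫⁻ x in Ω, ‖v t x‖ₑ ≤ ENNReal.ofReal ε) :
    ∀ᵐ z ∂(volume.restrict (cyl T Ω)), v z.1 z.2 = ∫ τ in Ioo 0 z.1, w τ z.2 := by
  have hcyl : IsOpen (cyl T Ω) := isOpen_Ioo.prod hΩ
  have hZ := integrableOn_time_primitive hw
  have key : ∀ᵐ z : ℝ × Eucl N, z ∈ cyl T Ω →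
      v z.1 z.2 - ∫ τ in Ioo 0 z.1, w τ z.2 = 0 := by
    refine hcyl.ae_eq_zero_of_integral_contDiff_smul_eq_zero (hv.sub hZ).locallyIntegrableOn
      fun ψ hψ hψs hsub => ?_
    obtain ⟨Ψ, hΨ, hd, ⟨b, hb, K, hK, hKΩ, hΨK⟩, hprim⟩ :=
      exists_smooth_time_primitive hT hψ hψs hsub
    have e1 := h.integral_mul_eq hΩ.measurableSet hv hw hinit hψ.continuous hψs hΨ hd hb hK hKΩ hΨK
    obtain ⟨E, hE⟩ := hψs.exists_bound_of_continuous hψ.continuous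
    have i1 : IntegrableOn (fun z : ℝ × Eucl N => v z.1 z.2 * ψ z) (cyl T Ω) :=
      Integrable.mul_bdd hv hψ.continuous.aestronglyMeasurable (Eventually.of_forall hE)
    have i2 : IntegrableOn (fun z : ℝ × Eucl N => (∫ τ in Ioo 0 z.1, w τ z.2) * ψ z) (cyl T Ω) :=
      Integrable.mul_bdd hZ hψ.continuous.aestronglyMeasurable (Eventually.of_forall hE)
    have i3 : IntegrableOn (fun z : ℝ × Eucl N => w z.1 z.2 * Ψ z) (cyl T Ω) := by
      obtain ⟨D, hD⟩ := ((isCompact_Icc (a := 0) (b := T)).prod hK).exists_bound_of_continuousOn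
        hΨ.continuous.continuousOn
      refine Integrable.mul_bdd (c := max D 0) hw hΨ.continuous.aestronglyMeasurable ?_
      filter_upwards [ae_restrict_mem hcyl.measurableSet] with z hz
      by_cases hx : z.2 ∈ K
      · exact (hD z ⟨Ioo_subset_Icc_self hz.1, hx⟩).trans (le_max_left _ _)
      · have : Ψ z = 0 := by
          by_contra hne
          exact hx (hΨK z.1 z.2 hne).2
        simp [this]
    have e2 : ∫ z in cyl T Ω, w z.1 z.2 * Ψ z =
        ∫ z in cyl T Ω, (∫ τ in Ioo 0 z.1, w τ z.2) * ψ z := by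
      rw [IntegrableOn, volume_restrict_cyl] at hw i2 i3
      rw [volume_restrict_cyl, integral_prod_symm _ i3, integral_prod_symm _ i2]
      refine integral_congr_ae ?_
      filter_upwards [hw.prod_left_ae] with x hx
      have hcx : IntegrableOn (fun t => ψ (t, x)) (Ioo 0 T) :=
        ((hψ.continuous.comp (by fun_prop : Continuous fun t : ℝ => (t, x))).integrableOn_Icc
          (a := 0) (b := T)).mono_set Ioo_subset_Icc_self
      rw [← integral_mul_integral_Ioo_swap hx hcx]
      exact setIntegral_congr_fun measurableSet_Ioo fun t ht => by
        simp only [hprim t ht x]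
    have e3 : ∀ z ∉ cyl T Ω, ψ z • (v z.1 z.2 - ∫ τ in Ioo 0 z.1, w τ z.2) = 0 := fun z hz => by
      rw [image_eq_zero_of_notMem_tsupport fun h' => hz (hsub h'), zero_smul]
    rw [← setIntegral_eq_integral_of_forall_compl_eq_zero e3]
    have e4 := integral_sub i1 i2
    rw [e1, e2, sub_self] at e4
    refine Eq.trans ?_ e4
    congr 1
    ext z
    rw [smul_eq_mul]
    ring
  rw [ae_restrict_iff' hcyl.measurableSet]
  filter_upwards [key] with z hz hm
  exact sub_eq_zero.1 (hz hm)

/-- As v is the primitive of w, the integral of w v over (0,t) × Ω is half the integral over Ω of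
the square of that primitive at time t. Its nonpositivity forces the primitive to vanish at each t.
-/
theorem ae_eq_zero_of_integral_mul_weakTimeDeriv_nonpos {v w : ℝ → Eucl N → ℝ} (hT : 0 < T)
    (h : HasWeakTimeDeriv T Ω v w) (hΩ : IsOpen Ω)
    (hv : IntegrableOn (fun z : ℝ × Eucl N => v z.1 z.2) (cyl T Ω))
    (hw : IntegrableOn (fun z : ℝ × Eucl N => w z.1 z.2) (cyl T Ω))
    (hvw : IntegrableOn (fun z : ℝ × Eucl N => w z.1 z.2 * v z.1 z.2) (cyl T Ω))
    (hinit : ∀ ε > 0, ∃ δ > 0, ∀ᵐ t, t ∈ Ioo 0 δ → ∫⁻ x in Ω, ‖v t x‖ₑ ≤ ENNReal.ofReal ε)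
    (hle : ∀ t ∈ Ioc 0 T, ∫ z in cyl t Ω, w z.1 z.2 * v z.1 z.2 ≤ 0) :
    ∀ᵐ z ∂(volume.restrict (cyl T Ω)), v z.1 z.2 = 0 := by
  have hprim := h.ae_eq_primitive hT hΩ hv hw hinit
  have hzero : ∀ t ∈ Ioc 0 T, ∀ᵐ x ∂(volume.restrict Ω), ∫ τ in Ioo 0 t, w τ x = 0 := by
    intro t ht
    have hsub := cyl_subset_cyl ht.2 Ω
    have hp : ∀ᵐ z ∂(volume.restrict (cyl t Ω)), w z.1 z.2 * v z.1 z.2 =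
        w z.1 z.2 * ∫ τ in Ioo 0 z.1, w τ z.2 := by
      filter_upwards [ae_restrict_of_ae_restrict_of_subset hsub hprim] with z hz
      rw [hz]
    have hi : Integrable (fun z : ℝ × Eucl N => w z.1 z.2 * ∫ τ in Ioo 0 z.1, w τ z.2)
        ((volume.restrict (Ioo 0 t)).prod (volume.restrict Ω)) := by
      rw [← volume_restrict_cyl]
      exact Integrable.congr (hvw.mono_set hsub) hp
    have hwt : Integrable (fun z : ℝ × Eucl N => w z.1 z.2)
        ((volume.restrict (Ioo 0 t)).prod (volume.restrict Ω)) := by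
      rw [← volume_restrict_cyl]
      exact hw.mono_set hsub
    have hsq : (fun x => ∫ s in Ioo 0 t, w s x * ∫ τ in Ioo 0 s, w τ x) =ᵐ[volume.restrict Ω]
        fun x => (∫ τ in Ioo 0 t, w τ x) ^ 2 / 2 := by
      filter_upwards [hwt.prod_left_ae] with x hx
      exact integral_mul_primitive_eq_half_sq hx
    have hint : Integrable (fun x => (∫ τ in Ioo 0 t, w τ x) ^ 2 / 2) (volume.restrict Ω) :=
      hi.integral_prod_right.congr hsq
    have hle' := hle t ht
    rw [integral_congr_ae hp, volume_restrict_cyl, integral_prod_symm _ hi,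
      integral_congr_ae hsq] at hle'
    have hnn : 0 ≤ fun x => (∫ τ in Ioo 0 t, w τ x) ^ 2 / 2 := fun x => by positivity
    have h0 := (integral_eq_zero_iff_of_nonneg hnn hint).1
      (le_antisymm hle' (integral_nonneg hnn))
    filter_upwards [h0] with x hx
    simpa using hx
  have hm := hv.aestronglyMeasurable
  rw [volume_restrict_cyl] at hprim hm ⊢
  -- The exceptional set of points x depends on t; a measurable representative allows Fubini.
  have hmk : ∀ᵐ z ∂((volume.restrict (Ioo 0 T)).prod (volume.restrict Ω)), hm.mk _ z = 0 := by
    have hset : MeasurableSet {z | hm.mk _ z = 0} :=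
      hm.stronglyMeasurable_mk.measurable (measurableSet_singleton 0)
    rw [Measure.ae_prod_iff_ae_ae hset]
    filter_upwards [Measure.ae_ae_of_ae_prod hm.ae_eq_mk, Measure.ae_ae_of_ae_prod hprim,
      ae_restrict_mem measurableSet_Ioo] with t h1 h2 h3
    filter_upwards [h1, h2, hzero t ⟨h3.1, h3.2.le⟩] with x k1 k2 k3
    rw [← k1, k2, k3]
  filter_upwards [hm.ae_eq_mk, hmk] with z h1 h2
  rw [h1, h2]

/-- Equality of initial values, in the form of decay of the `L¹` norm of the difference. -/
theorem HasInitialValue.lintegral_sub_le {v₁ v₂ : ℝ → Eucl N → ℝ} {v₀ : Eucl N → ℝ}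
    (hT : 0 < T) (hΩ : Bornology.IsBounded Ω)
    (h₁ : HasInitialValue Ω v₁ v₀) (h₂ : HasInitialValue Ω v₂ v₀)
    (hm₁ : ∀ᵐ t ∂(volume.restrict (Ioo 0 T)), AEStronglyMeasurable (v₁ t) (volume.restrict Ω))
    (hm₂ : ∀ᵐ t ∂(volume.restrict (Ioo 0 T)), AEStronglyMeasurable (v₂ t) (volume.restrict Ω))
    (hm₀ : AEStronglyMeasurable v₀ (volume.restrict Ω)) {ε : ℝ} (hε : 0 < ε) :
    ∃ δ > 0, ∀ᵐ t, t ∈ Ioo 0 δ → ∫⁻ x in Ω, ‖v₁ t x - v₂ t x‖ₑ ≤ ENNReal.ofReal ε := by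
  have hsum := h₁.add h₂
  rw [add_zero] at hsum
  -- The Hölder constant for passing from L² to L¹ on the bounded set Ω.
  have hfin : volume Ω ^ (1 / (1 : ℝ≥0∞).toReal - 1 / (2 : ℝ≥0∞).toReal) ≠ ⊤ :=
    ENNReal.rpow_ne_top_of_nonneg (by norm_num) hΩ.measure_lt_top.ne
  have hmul := ENNReal.Tendsto.mul_const (b := volume Ω ^
    (1 / (1 : ℝ≥0∞).toReal - 1 / (2 : ℝ≥0∞).toReal)) hsum (Or.inr hfin)
  rw [zero_mul] at hmul
  have hev := hmul.eventually (ge_mem_nhds (ENNReal.ofReal_pos.2 hε))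
  rw [Filter.eventually_inf] at hev
  obtain ⟨s, hs, t, ht, hst⟩ := hev
  obtain ⟨δ, hδ, hδs⟩ := mem_nhdsGT_iff_exists_Ioo_subset.1 hs
  refine ⟨min δ T, lt_min hδ hT, ?_⟩
  rw [ae_restrict_iff' measurableSet_Ioo] at hm₁ hm₂
  filter_upwards [ht, hm₁, hm₂] with τ h1 h2 h3 hτ
  have hτT : τ ∈ Ioo 0 T := ⟨hτ.1, hτ.2.trans_le (min_le_right _ _)⟩
  have h4 := hst τ ⟨hδs ⟨hτ.1, hτ.2.trans_le (min_le_left _ _)⟩, h1⟩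
  refine le_trans ?_ h4
  have e : ∫⁻ x in Ω, ‖v₁ τ x - v₂ τ x‖ₑ =
      eLpNorm (fun x => v₁ τ x - v₂ τ x) 1 (volume.restrict Ω) := by
    rw [eLpNorm_one_eq_lintegral_enorm]
  rw [e]
  have a1 := (h2 hτT).sub hm₀
  have a2 := (h3 hτT).sub hm₀
  refine (eLpNorm_le_eLpNorm_mul_rpow_measure_univ (p := 1) (q := 2) (by norm_num)
    ((h2 hτT).sub (h3 hτT))).trans ?_
  rw [Measure.restrict_apply_univ]
  gcongr
  refine le_trans (le_of_eq ?_) (eLpNorm_sub_le a1 a2 (by norm_num))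
  congr 1
  ext x
  simp

end TimePrimitive

/-! ### The regularized Picone test function -/

noncomputable section

/-- The function `(a, b) ↦ ((a + ε)^r - (b + ε)^r) / (a + ε)^{r-1}`. -/
def quotientTest (r ε : ℝ) (z : ℝ × ℝ) : ℝ :=
  (z.1 + ε) - (z.2 + ε) ^ r * (z.1 + ε) ^ (1 - r)

/-- The first partial derivative of `quotientTest`. -/
def quotientTestFst (r ε : ℝ) (z : ℝ × ℝ) : ℝ :=
  1 + (r - 1) * ((z.2 + ε) ^ r * (z.1 + ε) ^ (-r))

/-- The second partial derivative of `quotientTest`. -/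
def quotientTestSnd (r ε : ℝ) (z : ℝ × ℝ) : ℝ :=
  -(r * ((z.2 + ε) ^ (r - 1) * (z.1 + ε) ^ (1 - r)))

end

section QuotientTest

variable {p r ε a b M : ℝ}

theorem quotientTest_zero (hε : 0 < ε) : quotientTest r ε (0, 0) = 0 := by
  simp only [quotientTest, zero_add]
  rw [← Real.rpow_add hε]
  simp

theorem hasFDerivAt_quotientTest (hε : 0 < ε) {z : ℝ × ℝ} (h1 : 0 ≤ z.1) (h2 : 0 ≤ z.2) :
    HasFDerivAt (quotientTest r ε) (quotientTestFst r ε z • ContinuousLinearMap.fst ℝ ℝ ℝ +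
      quotientTestSnd r ε z • ContinuousLinearMap.snd ℝ ℝ ℝ) z := by
  have f1 : HasFDerivAt (fun z : ℝ × ℝ => z.1 + ε) (ContinuousLinearMap.fst ℝ ℝ ℝ) z :=
    hasFDerivAt_fst.add_const ε
  have f2 : HasFDerivAt (fun z : ℝ × ℝ => z.2 + ε) (ContinuousLinearMap.snd ℝ ℝ ℝ) z :=
    hasFDerivAt_snd.add_const ε
  have p1 : z.1 + ε ≠ 0 := by positivity
  have p2 : z.2 + ε ≠ 0 := by positivity
  refine (f1.sub ((f2.rpow_const (p := r) (Or.inl p2)).mul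
    (f1.rpow_const (p := 1 - r) (Or.inl p1)))).congr_fderiv ?_
  rw [show 1 - r - 1 = -r by ring]
  ext <;> simp [quotientTestFst, quotientTestSnd] <;> ring

theorem continuousOn_quotientTestFst (hε : 0 < ε) :
    ContinuousOn (quotientTestFst r ε) (Icc 0 M ×ˢ Icc 0 M) := by
  refine continuousOn_const.add (continuousOn_const.mul (ContinuousOn.mul ?_ ?_)) <;>
  refine ContinuousOn.rpow_const (by fun_prop) fun z hz => Or.inl ?_
  · have := hz.2.1; positivity
  · have := hz.1.1; positivity

theorem continuousOn_quotientTestSnd (hε : 0 < ε) :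
    ContinuousOn (quotientTestSnd r ε) (Icc 0 M ×ˢ Icc 0 M) := by
  refine (continuousOn_const.mul (ContinuousOn.mul ?_ ?_)).neg <;>
  refine ContinuousOn.rpow_const (by fun_prop) fun z hz => Or.inl ?_
  · have := hz.2.1; positivity
  · have := hz.1.1; positivity

theorem rpow_mul_quotientTest (hε : 0 < ε) (ha : 0 ≤ a) :
    (a + ε) ^ (r - 1) * quotientTest r ε (a, b) = (a + ε) ^ r - (b + ε) ^ r := by
  have h : 0 < a + ε := by positivity
  have e1 : (a + ε) ^ (r - 1) * (a + ε) = (a + ε) ^ r := by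
    rw [← Real.rpow_add_one h.ne', sub_add_cancel]
  have e2 : (a + ε) ^ (r - 1) * (a + ε) ^ (1 - r) = 1 := by
    rw [← Real.rpow_add h]; simp
  simp only [quotientTest]
  linear_combination e1 - (b + ε) ^ r * e2

/-- By Young's inequality the numerator is at most r (a+ε)^(r-1) (a - b). The bound is uniform in ε
and one-sided: for r > 1 and b > 0, the subtracted term can blow up as a and ε tend to zero. -/
theorem quotientTest_le (hr : 1 ≤ r) (hε : 0 < ε) (ha : 0 ≤ a) (hb : 0 ≤ b) :
    quotientTest r ε (a, b) ≤ r * a := by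
  have h : 0 < a + ε := by positivity
  have hy := Real.young_rpow_sub_one_mul hr h.le (by positivity : 0 ≤ b + ε)
  have e1 : (a + ε) ^ (r - 1) * (a + ε) = (a + ε) ^ r := by
    rw [← Real.rpow_add_one h.ne', sub_add_cancel]
  have hpos : 0 < (a + ε) ^ (r - 1) := by positivity
  refine le_trans ?_ (mul_le_mul_of_nonneg_left (sub_le_self a hb) (by linarith : 0 ≤ r))
  refine le_of_mul_le_mul_left ?_ hpos
  rw [rpow_mul_quotientTest hε ha]
  rw [← e1] at hy ⊢
  linarith

/-- The factor a^m ≤ (a+ε)^m compensates the denominator, which gives a bound uniform in ε for the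
time terms and the g-terms. -/
theorem abs_rpow_mul_quotientTest_le {m : ℝ} (hm : 0 ≤ m) (hε : 0 < ε) (hε1 : ε ≤ 1)
    (ha : a ∈ Icc 0 M) (hb : b ∈ Icc 0 M) :
    |a ^ m * quotientTest (m + 1) ε (a, b)| ≤ (M + 1) ^ (m + 1) := by
  have hM : 0 ≤ M := ha.1.trans ha.2
  have h1 : a ^ m ≤ (a + ε) ^ m := Real.rpow_le_rpow ha.1 (by linarith) hm
  have h2 := rpow_mul_quotientTest (r := m + 1) (b := b) hε ha.1
  rw [add_sub_cancel_right] at h2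
  have hA := ha.1
  have hB := hb.1
  calc |a ^ m * quotientTest (m + 1) ε (a, b)|
      = a ^ m * |quotientTest (m + 1) ε (a, b)| := by
        rw [abs_mul, abs_of_nonneg (Real.rpow_nonneg hA m)]
    _ ≤ (a + ε) ^ m * |quotientTest (m + 1) ε (a, b)| := by gcongr
    _ = |(a + ε) ^ (m + 1) - (b + ε) ^ (m + 1)| := by
        rw [← h2, abs_mul, abs_of_nonneg (by positivity : 0 ≤ (a + ε) ^ m)]
    _ ≤ (M + 1) ^ (m + 1) := by
        have k1 : (a + ε) ^ (m + 1) ≤ (M + 1) ^ (m + 1) :=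
          Real.rpow_le_rpow (by positivity) (by linarith [ha.2]) (by linarith)
        have k2 : (b + ε) ^ (m + 1) ≤ (M + 1) ^ (m + 1) :=
          Real.rpow_le_rpow (by positivity) (by linarith [hb.2]) (by linarith)
        have k3 : 0 ≤ (a + ε) ^ (m + 1) := by positivity
        have k4 : 0 ≤ (b + ε) ^ (m + 1) := by positivity
        rw [abs_le]
        constructor <;> linarith

theorem tendsto_quotientTest (ha : 0 < a) (hb : 0 < b) :
    Tendsto (fun n : ℕ => quotientTest r (1 / ((n : ℝ) + 1)) (a, b)) atTop
      (𝓝 (a - b ^ r * a ^ (1 - r))) := by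
  have h0 := tendsto_one_div_add_atTop_nhds_zero_nat (𝕜 := ℝ)
  have hA : Tendsto (fun n : ℕ => a + 1 / ((n : ℝ) + 1)) atTop (𝓝 a) := by
    simpa using h0.const_add a
  have hB : Tendsto (fun n : ℕ => b + 1 / ((n : ℝ) + 1)) atTop (𝓝 b) := by
    simpa using h0.const_add b
  exact hA.sub ((hB.rpow_const (Or.inl hb.ne')).mul (hA.rpow_const (Or.inl ha.ne')))

theorem rpow_mul_sub_rpow {m : ℝ} (ha : 0 < a) :
    a ^ m * (a - b ^ (m + 1) * a ^ (1 - (m + 1))) = a ^ (m + 1) - b ^ (m + 1) := by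
  have e1 : a ^ m * a = a ^ (m + 1) := (Real.rpow_add_one ha.ne' m).symm
  have e2 : a ^ m * a ^ (1 - (m + 1)) = 1 := by
    rw [← Real.rpow_add ha]; simp
  linear_combination e1 - b ^ (m + 1) * e2

/-- The sum factors as (a^(δ-m) - b^(δ-m)) (a^(m+1) - b^(m+1)): a nonincreasing power against an
increasing one. -/
theorem source_pair_nonpos {m δ : ℝ} (hm : 0 ≤ m) (hδ : δ ≤ m) (ha : 0 < a) (hb : 0 < b) :
    a ^ δ * (a - b ^ (m + 1) * a ^ (1 - (m + 1))) +
      b ^ δ * (b - a ^ (m + 1) * b ^ (1 - (m + 1))) ≤ 0 := by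
  have e : ∀ x : ℝ, 0 < x → x ^ δ = x ^ (δ - m) * x ^ m := fun x hx => by
    rw [← Real.rpow_add hx, sub_add_cancel]
  have h : a ^ δ * (a - b ^ (m + 1) * a ^ (1 - (m + 1))) +
      b ^ δ * (b - a ^ (m + 1) * b ^ (1 - (m + 1))) =
      (a ^ (δ - m) - b ^ (δ - m)) * (a ^ (m + 1) - b ^ (m + 1)) := by
    rw [e a ha, e b hb, mul_assoc, mul_assoc, rpow_mul_sub_rpow ha, rpow_mul_sub_rpow hb]
    ring
  rw [h]
  rcases le_total a b with hab | hab
  · have h1 := Real.rpow_le_rpow_of_nonpos ha hab (sub_nonpos.2 hδ)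
    have h2 := Real.rpow_le_rpow ha.le hab (by linarith : 0 ≤ m + 1)
    exact mul_nonpos_of_nonneg_of_nonpos (by linarith) (by linarith)
  · have h1 := Real.rpow_le_rpow_of_nonpos hb hab (sub_nonpos.2 hδ)
    have h2 := Real.rpow_le_rpow hb.le hab (by linarith : 0 ≤ m + 1)
    exact mul_nonpos_of_nonpos_of_nonneg (by linarith) (by linarith)

/-- Picone's inequality is used at (a+ε, b+ε) and with the roles exchanged;
`Real.rpow_sub_mul_rpow_add_le` makes the sum of the two lower bounds nonnegative. -/
theorem local_pair_nonneg {E : Type*} [NormedAddCommGroup E] [InnerProductSpace ℝ E]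
    (hp : 1 < p) (hr : 1 ≤ r) (hrp : r ≤ p) (hε : 0 < ε) (ha : 0 ≤ a) (hb : 0 ≤ b) (A B : E) :
    0 ≤ ‖A‖ ^ (p - 2) *
        inner ℝ A (quotientTestFst r ε (a, b) • A + quotientTestSnd r ε (a, b) • B) +
      ‖B‖ ^ (p - 2) *
        inner ℝ B (quotientTestFst r ε (b, a) • B + quotientTestSnd r ε (b, a) • A) := by
  have h1 := picone_inner hp hr (by positivity : 0 < a + ε) (by positivity : 0 < b + ε) A B
  have h2 := picone_inner hp hr (by positivity : 0 < b + ε) (by positivity : 0 < a + ε) B A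
  have h3 := Real.rpow_sub_mul_rpow_add_le (by linarith : 0 ≤ r) hrp (by linarith : 0 < p)
    (norm_nonneg A) (norm_nonneg B)
  simp only [quotientTestFst, quotientTestSnd, neg_smul, ← sub_eq_add_neg]
  linarith

/-- As in the local case, with the discrete Picone inequality; the shift by ε cancels in the
differences. -/
theorem nonlocal_pair_nonneg {a₁ a₂ b₁ b₂ : ℝ} (hp : 1 < p) (hr : 1 ≤ r) (hrp : r ≤ p)
    (hε : 0 < ε) (ha₁ : 0 ≤ a₁) (ha₂ : 0 ≤ a₂) (hb₁ : 0 ≤ b₁) (hb₂ : 0 ≤ b₂) :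
    0 ≤ |a₁ - a₂| ^ (p - 2) * (a₁ - a₂) *
        (quotientTest r ε (a₁, b₁) - quotientTest r ε (a₂, b₂)) +
      |b₁ - b₂| ^ (p - 2) * (b₁ - b₂) *
        (quotientTest r ε (b₁, a₁) - quotientTest r ε (b₂, a₂)) := by
  have key : ∀ d : ℝ, |d| ^ (p - 2) * d * d = |d| ^ p := fun d => by
    rcases eq_or_ne d 0 with rfl | hd
    · simp [Real.zero_rpow (by linarith : p ≠ 0)]
    · rw [mul_assoc, ← abs_mul_abs_self d, ← mul_assoc, ← Real.rpow_add_one (abs_ne_zero.2 hd),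
        ← Real.rpow_add_one (abs_ne_zero.2 hd)]
      congr 1
      ring
  have main : ∀ {a₁ a₂ b₁ b₂ : ℝ}, 0 ≤ a₁ → 0 ≤ a₂ → 0 ≤ b₁ → 0 ≤ b₂ →
      |a₁ - a₂| ^ p - |a₁ - a₂| ^ (p - r) * |b₁ - b₂| ^ r ≤ |a₁ - a₂| ^ (p - 2) * (a₁ - a₂) *
        (quotientTest r ε (a₁, b₁) - quotientTest r ε (a₂, b₂)) := by
    intro a₁ a₂ b₁ b₂ ha₁ ha₂ hb₁ hb₂
    have h := picone_discrete (p := p) hr (by positivity : 0 < a₁ + ε) (by positivity : 0 < a₂ + ε)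
      (by positivity : 0 ≤ b₁ + ε) (by positivity : 0 ≤ b₂ + ε)
    rw [add_sub_add_right_eq_sub, add_sub_add_right_eq_sub] at h
    have e := key (a₁ - a₂)
    simp only [quotientTest]
    linarith
  have h3 := Real.rpow_sub_mul_rpow_add_le (by linarith : 0 ≤ r) hrp (by linarith : 0 < p)
    (abs_nonneg (a₁ - a₂)) (abs_nonneg (b₁ - b₂))
  have h1 := main ha₁ ha₂ hb₁ hb₂
  have h2 := main hb₁ hb₂ ha₁ ha₂
  linarith

end QuotientTest

/-! ### Adding the two identities and letting ε tend to zero -/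

section Uniqueness

variable {N : ℕ} {p s m δ γ T M : ℝ} {Ω : Set (Eucl N)}

theorem ae_pair_of_ae_cyl {P : ℝ × Eucl N → Prop}
    (h : ∀ᵐ z ∂(volume.restrict (cyl T (univ : Set (Eucl N)))), P z) :
    ∀ᵐ z ∂(volume.restrict (Ioo 0 T ×ˢ (univ : Set (Eucl N × Eucl N)))),
      P (z.1, z.2.1) ∧ P (z.1, z.2.2) := by
  have e : (volume : Measure (ℝ × (Eucl N × Eucl N))).restrict (Ioo 0 T ×ˢ univ) =
      (volume.restrict (Ioo 0 T)).prod ((volume : Measure (Eucl N)).prod volume) := by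
    rw [Measure.volume_eq_prod, ← Measure.prod_restrict, Measure.restrict_univ,
      Measure.volume_eq_prod]
  rw [volume_restrict_cyl_univ] at h
  rw [e]
  exact ((QuasiMeasurePreserving.prodMap (Measure.QuasiMeasurePreserving.id _)
    Measure.quasiMeasurePreserving_fst).ae h).and
    ((QuasiMeasurePreserving.prodMap (Measure.QuasiMeasurePreserving.id _)
    Measure.quasiMeasurePreserving_snd).ae h)

theorem exists_ae_mem_Icc {u v : ℝ × Eucl N → ℝ} {μ : Measure (ℝ × Eucl N)} (hu : MemLp u ⊤ μ)
    (hv : MemLp v ⊤ μ) (hu0 : ∀ᵐ z ∂μ, 0 < u z) (hv0 : ∀ᵐ z ∂μ, 0 < v z) :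
    ∃ M, 0 ≤ M ∧ (∀ᵐ z ∂μ, u z ∈ Icc 0 M) ∧ ∀ᵐ z ∂μ, v z ∈ Icc 0 M := by
  have hb : ∀ {f : ℝ × Eucl N → ℝ}, MemLp f ⊤ μ → ∀ᵐ z ∂μ, |f z| ≤ (eLpNorm f ⊤ μ).toReal := by
    intro f hf
    have h := hf.2
    rw [eLpNorm_exponent_top] at h ⊢
    filter_upwards [ae_le_eLpNormEssSup (f := f) (μ := μ)] with z hz
    rw [← Real.norm_eq_abs, ← toReal_enorm]
    exact ENNReal.toReal_mono h.ne hz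
  refine ⟨max (eLpNorm u ⊤ μ).toReal (eLpNorm v ⊤ μ).toReal,
    le_max_of_le_left ENNReal.toReal_nonneg, ?_, ?_⟩
  · filter_upwards [hb hu, hu0] with z h1 h2
    exact ⟨h2.le, ((le_abs_self _).trans h1).trans (le_max_left _ _)⟩
  · filter_upwards [hb hv, hv0] with z h1 h2
    exact ⟨h2.le, ((le_abs_self _).trans h1).trans (le_max_right _ _)⟩

theorem HasWeakTimeDeriv.sub {v₁ v₂ w₁ w₂ : ℝ → Eucl N → ℝ}
    (h₁ : HasWeakTimeDeriv T Ω v₁ w₁) (h₂ : HasWeakTimeDeriv T Ω v₂ w₂)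
    (hv₁ : IntegrableOn (fun z : ℝ × Eucl N => v₁ z.1 z.2) (cyl T Ω))
    (hv₂ : IntegrableOn (fun z : ℝ × Eucl N => v₂ z.1 z.2) (cyl T Ω))
    (hw₁ : IntegrableOn (fun z : ℝ × Eucl N => w₁ z.1 z.2) (cyl T Ω))
    (hw₂ : IntegrableOn (fun z : ℝ × Eucl N => w₂ z.1 z.2) (cyl T Ω)) :
    HasWeakTimeDeriv T Ω (fun t x => v₁ t x - v₂ t x) (fun t x => w₁ t x - w₂ t x) := by
  intro ψ hψ hψs hsub
  have hdc : Continuous fun z => fderiv ℝ ψ z (1, 0) :=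
    (hψ.continuous_fderiv (by simp)).clm_apply continuous_const
  obtain ⟨C, hC⟩ := hψs.exists_bound_of_continuous hψ.continuous
  obtain ⟨D, hD⟩ := (hψs.fderiv_apply (𝕜 := ℝ) (1, 0)).exists_bound_of_continuous hdc
  have i : ∀ {f : ℝ × Eucl N → ℝ}, IntegrableOn f (cyl T Ω) →
      IntegrableOn (fun z => f z * ψ z) (cyl T Ω) := fun hf =>
    Integrable.mul_bdd hf hψ.continuous.aestronglyMeasurable (Eventually.of_forall hC)
  have j : ∀ {f : ℝ × Eucl N → ℝ}, IntegrableOn f (cyl T Ω) →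
      IntegrableOn (fun z => f z * fderiv ℝ ψ z (1, 0)) (cyl T Ω) := fun hf =>
    Integrable.mul_bdd hf hdc.aestronglyMeasurable (Eventually.of_forall hD)
  simp_rw [sub_mul]
  rw [integral_sub (j hv₁) (j hv₂), integral_sub (i hw₁) (i hw₂), h₁ ψ hψ hψs hsub,
    h₂ ψ hψ hψs hsub]
  ring

/-- The elliptic part of the difference of two solutions has a sign. -/
theorem integral_time_add_le_integral_source_add {t ε : ℝ} {g u v w y : ℝ → Eucl N → ℝ}
    {G K : ℝ → Eucl N → Eucl N} (hp : 1 < p) (hm₀ : 0 ≤ m) (hm₁ : m < p - 1) (hε : 0 < ε)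
    (ht : t ≤ T)
    (hu0 : ∀ᵐ z ∂(volume.restrict (cyl T (univ : Set (Eucl N)))), u z.1 z.2 ∈ Icc 0 M)
    (hv0 : ∀ᵐ z ∂(volume.restrict (cyl T (univ : Set (Eucl N)))), v z.1 z.2 ∈ Icc 0 M)
    {φ χ : ℝ → Eucl N → ℝ} {H J : ℝ → Eucl N → Eucl N}
    (hφ : φ = fun t x => quotientTest (m + 1) ε (u t x, v t x))
    (hχ : χ = fun t x => quotientTest (m + 1) ε (v t x, u t x))
    (hH : H = fun t x => quotientTestFst (m + 1) ε (u t x, v t x) • G t x +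
      quotientTestSnd (m + 1) ε (u t x, v t x) • K t x)
    (hJ : J = fun t x => quotientTestFst (m + 1) ε (v t x, u t x) • K t x +
      quotientTestSnd (m + 1) ε (v t x, u t x) • G t x)
    (hl₁ : IntegrableOn (localTerm p G H) (cyl T Ω))
    (hl₂ : IntegrableOn (localTerm p K J) (cyl T Ω))
    (hn₁ : IntegrableOn (nonlocalTerm p s u φ) (Ioo 0 T ×ˢ univ))
    (hn₂ : IntegrableOn (nonlocalTerm p s v χ) (Ioo 0 T ×ˢ univ))
    (h₁ : (∫ z in cyl t Ω, timeTerm m u w φ z) + (∫ z in cyl t Ω, localTerm p G H z)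
      + (∫ z in Ioo 0 t ×ˢ univ, nonlocalTerm p s u φ z)
      = ∫ z in cyl t Ω, sourceTerm m δ γ Ω g u φ z)
    (h₂ : (∫ z in cyl t Ω, timeTerm m v y χ z) + (∫ z in cyl t Ω, localTerm p K J z)
      + (∫ z in Ioo 0 t ×ˢ univ, nonlocalTerm p s v χ z)
      = ∫ z in cyl t Ω, sourceTerm m δ γ Ω g v χ z) :
    (∫ z in cyl t Ω, timeTerm m u w φ z) + (∫ z in cyl t Ω, timeTerm m v y χ z) ≤
      (∫ z in cyl t Ω, sourceTerm m δ γ Ω g u φ z) +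
        ∫ z in cyl t Ω, sourceTerm m δ γ Ω g v χ z := by
  have hr : 1 ≤ m + 1 := by linarith
  have hrp : m + 1 ≤ p := by linarith
  have hsub := cyl_subset_cyl ht Ω
  have hsub' : Ioo 0 t ×ˢ (univ : Set (Eucl N × Eucl N)) ⊆ Ioo 0 T ×ˢ univ :=
    prod_mono_left (Ioo_subset_Ioo_right ht)
  have hloc : 0 ≤ (∫ z in cyl t Ω, localTerm p G H z) + ∫ z in cyl t Ω, localTerm p K J z := by
    rw [← integral_add (hl₁.mono_set hsub) (hl₂.mono_set hsub)]
    have hs := hsub.trans (cyl_subset_univ T Ω)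
    refine integral_nonneg_of_ae ?_
    filter_upwards [ae_restrict_of_ae_restrict_of_subset hs hu0,
      ae_restrict_of_ae_restrict_of_subset hs hv0] with z k1 k2
    subst hH hJ
    exact local_pair_nonneg hp hr hrp hε k1.1 k2.1 _ _
  have hnon : 0 ≤ (∫ z in Ioo 0 t ×ˢ univ, nonlocalTerm p s u φ z) +
      ∫ z in Ioo 0 t ×ˢ univ, nonlocalTerm p s v χ z := by
    rw [← integral_add (hn₁.mono_set hsub') (hn₂.mono_set hsub')]
    refine integral_nonneg_of_ae ?_
    filter_upwards [ae_restrict_of_ae_restrict_of_subset hsub' (ae_pair_of_ae_cyl hu0),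
      ae_restrict_of_ae_restrict_of_subset hsub' (ae_pair_of_ae_cyl hv0)] with z k1 k2
    subst hφ hχ
    simp only [nonlocalTerm, Pi.zero_apply]
    rw [← add_div]
    exact div_nonneg (nonlocal_pair_nonneg hp hr hrp hε k1.1.1 k1.2.1 k2.1.1 k2.2.1)
      (Real.rpow_nonneg (norm_nonneg _) _)
  linarith

/-- With A the g-part, B the singular part and ε = 1/(n+1), the integrand A + max(B, 0) minus the
time terms has nonnegative integral for each n and a fixed integrable majorant. In the limit A
cancels and max(B, 0) vanishes, so only the time terms remain. -/
theorem integral_weakTimeDeriv_mul_le_zero {g u v w y : ℝ × Eucl N → ℝ}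
    {d : ℝ × Eucl N → ℝ} {μ : Measure (ℝ × Eucl N)} (hm₀ : 0 ≤ m) (hδ : 0 < m → δ ≤ m)
    (hd : ∀ z, 0 ≤ d z)
    (hu : ∀ᵐ z ∂μ, u z ∈ Icc 0 M) (hv : ∀ᵐ z ∂μ, v z ∈ Icc 0 M)
    (hupos : ∀ᵐ z ∂μ, 0 < u z) (hvpos : ∀ᵐ z ∂μ, 0 < v z)
    (hum : AEStronglyMeasurable u μ) (hvm : AEStronglyMeasurable v μ)
    (hg : Integrable g μ) (hw : Integrable w μ) (hy : Integrable y μ)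
    (hdu : Integrable (fun z => m * d z * u z ^ δ * u z) μ)
    (hdv : Integrable (fun z => m * d z * v z ^ δ * v z) μ)
    (hS₁ : ∀ n : ℕ, Integrable (fun z => (g z * u z ^ m + m * d z * u z ^ δ) *
      quotientTest (m + 1) (1 / ((n : ℝ) + 1)) (u z, v z)) μ)
    (hS₂ : ∀ n : ℕ, Integrable (fun z => (g z * v z ^ m + m * d z * v z ^ δ) *
      quotientTest (m + 1) (1 / ((n : ℝ) + 1)) (v z, u z)) μ)
    (hT₁ : ∀ n : ℕ, Integrable (fun z => u z ^ m * w z *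
      quotientTest (m + 1) (1 / ((n : ℝ) + 1)) (u z, v z)) μ)
    (hT₂ : ∀ n : ℕ, Integrable (fun z => v z ^ m * y z *
      quotientTest (m + 1) (1 / ((n : ℝ) + 1)) (v z, u z)) μ)
    (hle : ∀ n : ℕ, (∫ z, u z ^ m * w z *
        quotientTest (m + 1) (1 / ((n : ℝ) + 1)) (u z, v z) ∂μ) +
      (∫ z, v z ^ m * y z * quotientTest (m + 1) (1 / ((n : ℝ) + 1)) (v z, u z) ∂μ) ≤
      (∫ z, (g z * u z ^ m + m * d z * u z ^ δ) *
        quotientTest (m + 1) (1 / ((n : ℝ) + 1)) (u z, v z) ∂μ) +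
      ∫ z, (g z * v z ^ m + m * d z * v z ^ δ) *
        quotientTest (m + 1) (1 / ((n : ℝ) + 1)) (v z, u z) ∂μ) :
    ∫ z, (w z - y z) * (u z ^ (m + 1) - v z ^ (m + 1)) ∂μ ≤ 0 := by
  set φ : ℕ → ℝ × Eucl N → ℝ := fun n z =>
    quotientTest (m + 1) (1 / ((n : ℝ) + 1)) (u z, v z) with hφ
  set χ : ℕ → ℝ × Eucl N → ℝ := fun n z =>
    quotientTest (m + 1) (1 / ((n : ℝ) + 1)) (v z, u z) with hχ
  set A : ℕ → ℝ × Eucl N → ℝ := fun n z => g z * (u z ^ m * φ n z) + g z * (v z ^ m * χ n z)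
  set B : ℕ → ℝ × Eucl N → ℝ := fun n z =>
    m * d z * (u z ^ δ * φ n z + v z ^ δ * χ n z) with hB
  have hεpos : ∀ n : ℕ, (0 : ℝ) < 1 / ((n : ℝ) + 1) := fun n => by positivity
  have hε1 : ∀ n : ℕ, 1 / ((n : ℝ) + 1) ≤ 1 := fun n => by
    rw [div_le_one (by positivity)]; linarith [(Nat.cast_nonneg n : (0 : ℝ) ≤ n)]
  set R := (M + 1) ^ (m + 1)
  have bu : ∀ n, ∀ᵐ z ∂μ, ‖u z ^ m * φ n z‖ ≤ R := fun n => by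
    filter_upwards [hu, hv] with z h1 h2
    exact abs_rpow_mul_quotientTest_le hm₀ (hεpos n) (hε1 n) h1 h2
  have bv : ∀ n, ∀ᵐ z ∂μ, ‖v z ^ m * χ n z‖ ≤ R := fun n => by
    filter_upwards [hu, hv] with z h1 h2
    exact abs_rpow_mul_quotientTest_le hm₀ (hεpos n) (hε1 n) h2 h1
  have hφm : ∀ n, AEStronglyMeasurable (φ n) μ ∧ AEStronglyMeasurable (χ n) μ := fun n => by
    have hA := hum.aemeasurable
    have hC := hvm.aemeasurable
    constructor <;> refine AEMeasurable.aestronglyMeasurable ?_ <;>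
    · simp only [hφ, hχ, quotientTest]
      fun_prop
  have hum' : AEStronglyMeasurable (fun z => u z ^ m) μ :=
    (Real.continuous_rpow_const hm₀).comp_aestronglyMeasurable hum
  have hvm' : AEStronglyMeasurable (fun z => v z ^ m) μ :=
    (Real.continuous_rpow_const hm₀).comp_aestronglyMeasurable hvm
  have hAi : ∀ n, Integrable (A n) μ := fun n =>
    (hg.mul_bdd (hum'.mul (hφm n).1) (bu n)).add (hg.mul_bdd (hvm'.mul (hφm n).2) (bv n))
  -- Only the full source is known to be integrable; the singular part is obtained by subtracting
  -- the g-part.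
  have hBi : ∀ n, Integrable (B n) μ := fun n => by
    refine (((hS₁ n).add (hS₂ n)).sub (hAi n)).congr (Eventually.of_forall fun z => ?_)
    simp only [Pi.add_apply, Pi.sub_apply, A, B, φ, χ]
    ring
  have hBle : ∀ n, ∀ᵐ z ∂μ, B n z ≤
      (m + 1) * (m * d z * u z ^ δ * u z) + (m + 1) * (m * d z * v z ^ δ * v z) := fun n => by
    filter_upwards [hu, hv] with z h1 h2
    have hr : 1 ≤ m + 1 := by linarith
    have k1 := quotientTest_le hr (hεpos n) h1.1 h2.1
    have k2 := quotientTest_le hr (hεpos n) h2.1 h1.1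
    have c1 : 0 ≤ m * d z * u z ^ δ :=
      mul_nonneg (mul_nonneg hm₀ (hd z)) (Real.rpow_nonneg h1.1 _)
    have c2 : 0 ≤ m * d z * v z ^ δ :=
      mul_nonneg (mul_nonneg hm₀ (hd z)) (Real.rpow_nonneg h2.1 _)
    have l1 := mul_le_mul_of_nonneg_left k1 c1
    have l2 := mul_le_mul_of_nonneg_left k2 c2
    simp only [hB, hφ, hχ]
    linarith
  have hlim : ∀ᵐ z ∂μ, Tendsto (fun n => A n z + max (B n z) 0 -
      (u z ^ m * w z * φ n z + v z ^ m * y z * χ n z)) atTop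
      (𝓝 (-((w z - y z) * (u z ^ (m + 1) - v z ^ (m + 1))))) := by
    filter_upwards [hupos, hvpos] with z h1 h2
    have t1 : Tendsto (fun n => φ n z) atTop (𝓝 _) := tendsto_quotientTest (r := m + 1) h1 h2
    have t2 : Tendsto (fun n => χ n z) atTop (𝓝 _) := tendsto_quotientTest (r := m + 1) h2 h1
    have tB : Tendsto (fun n => max (B n z) 0) atTop (𝓝 0) := by
      have t3 : Tendsto (fun n => B n z) atTop (𝓝 _) :=
        ((t1.const_mul (u z ^ δ)).add (t2.const_mul (v z ^ δ))).const_mul (m * d z)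
      have t4 := t3.max (tendsto_const_nhds (x := (0 : ℝ)))
      rwa [max_eq_right] at t4
      -- For m = 0 the factor m removes the singular term, and no restriction on δ is available.
      rcases hm₀.eq_or_lt with h0 | h0
      · rw [← h0]; simp
      · exact mul_nonpos_of_nonneg_of_nonpos (mul_nonneg hm₀ (hd z))
          (source_pair_nonpos hm₀ (hδ h0) h1 h2)
    have tA : Tendsto (fun n => A n z) atTop (𝓝 _) :=
      ((t1.const_mul (u z ^ m)).const_mul (g z)).add ((t2.const_mul (v z ^ m)).const_mul (g z))
    have tT := (t1.const_mul (u z ^ m * w z)).add (t2.const_mul (v z ^ m * y z))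
    have := (tA.add tB).sub tT
    refine this.trans (le_of_eq ?_)
    congr 1
    have e1 := rpow_mul_sub_rpow (b := v z) (m := m) h1
    have e2 := rpow_mul_sub_rpow (b := u z) (m := m) h2
    linear_combination (g z - w z) * e1 + (g z - y z) * e2
  have hmax : ∀ n, Integrable (fun z => max (B n z) 0) μ := fun n => (hBi n).pos_part
  have hL := tendsto_integral_of_dominated_convergence
    (bound := fun z => ‖g z‖ * (2 * R) + ((m + 1) * (m * d z * u z ^ δ * u z) +
      (m + 1) * (m * d z * v z ^ δ * v z)) + (‖w z‖ * R + ‖y z‖ * R))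
    (fun n => (((hAi n).add (hmax n)).sub ((hT₁ n).add (hT₂ n))).aestronglyMeasurable)
    (((hg.norm.mul_const _).add ((hdu.const_mul _).add (hdv.const_mul _))).add
      ((hw.norm.mul_const _).add (hy.norm.mul_const _))) (fun n => ?_) hlim
  · have hnn : ∀ n, 0 ≤ ∫ z, (A n z + max (B n z) 0 -
        (u z ^ m * w z * φ n z + v z ^ m * y z * χ n z)) ∂μ := fun n => by
      have k1 : ∫ z, (A n z + max (B n z) 0 -
          (u z ^ m * w z * φ n z + v z ^ m * y z * χ n z)) ∂μ =
          (∫ z, (A n z + max (B n z) 0) ∂μ) -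
            ((∫ z, u z ^ m * w z * φ n z ∂μ) + ∫ z, v z ^ m * y z * χ n z ∂μ) := by
        rw [← integral_add (hT₁ n) (hT₂ n)]
        exact integral_sub ((hAi n).add (hmax n)) ((hT₁ n).add (hT₂ n))
      have k2 : (∫ z, (g z * u z ^ m + m * d z * u z ^ δ) * φ n z ∂μ) +
          (∫ z, (g z * v z ^ m + m * d z * v z ^ δ) * χ n z ∂μ) ≤
          ∫ z, (A n z + max (B n z) 0) ∂μ := by
        rw [← integral_add (hS₁ n) (hS₂ n)]
        refine integral_mono ((hS₁ n).add (hS₂ n)) ((hAi n).add (hmax n)) fun z => ?_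
        have := le_max_left (B n z) 0
        simp only [A, B, φ, χ] at this ⊢
        linarith
      have k3 := hle n
      rw [k1]
      linarith
    have h0 := ge_of_tendsto' hL hnn
    rw [integral_neg] at h0
    linarith
  · filter_upwards [bu n, bv n, hBle n, hu, hv] with z h1 h2 h3 h4 h5
    have c0 : 0 ≤ (m + 1) * (m * d z * u z ^ δ * u z) + (m + 1) * (m * d z * v z ^ δ * v z) := by
      have := hd z
      have := Real.rpow_nonneg h4.1 δ
      have := Real.rpow_nonneg h5.1 δ
      have := h4.1
      have := h5.1
      positivity
    have a1 : ‖A n z‖ ≤ ‖g z‖ * (2 * R) := by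
      refine (norm_add_le _ _).trans ?_
      rw [norm_mul (g z), norm_mul (g z), two_mul, mul_add]
      exact add_le_add (mul_le_mul_of_nonneg_left h1 (norm_nonneg _))
        (mul_le_mul_of_nonneg_left h2 (norm_nonneg _))
    have a2 : ‖max (B n z) 0‖ ≤ (m + 1) * (m * d z * u z ^ δ * u z) +
        (m + 1) * (m * d z * v z ^ δ * v z) := by
      rw [Real.norm_of_nonneg (le_max_right _ _)]
      exact max_le h3 c0
    have a3 : ‖u z ^ m * w z * φ n z + v z ^ m * y z * χ n z‖ ≤ ‖w z‖ * R + ‖y z‖ * R := by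
      refine (norm_add_le _ _).trans ?_
      rw [mul_comm (u z ^ m), mul_assoc, norm_mul (w z), mul_comm (v z ^ m), mul_assoc,
        norm_mul (y z)]
      exact add_le_add (mul_le_mul_of_nonneg_left h1 (norm_nonneg _))
        (mul_le_mul_of_nonneg_left h2 (norm_nonneg _))
    exact (norm_sub_le _ _).trans (add_le_add ((norm_add_le _ _).trans (add_le_add a1 a2)) a3)

end Uniqueness

/-! ### Application to a pair of weak solutions -/

section Uniqueness

variable {N : ℕ} {p s m δ γ T M : ℝ} {Ω : Set (Eucl N)}

theorem memLp_quotientTest {ε : ℝ} {u v : ℝ → Eucl N → ℝ} (hΩ : Bornology.IsBounded Ω)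
    (hM : 0 ≤ M) (hε : 0 < ε)
    (hum : AEStronglyMeasurable (fun z : ℝ × Eucl N => u z.1 z.2) (volume.restrict (cyl T Ω)))
    (hvm : AEStronglyMeasurable (fun z : ℝ × Eucl N => v z.1 z.2) (volume.restrict (cyl T Ω)))
    (hu : ∀ᵐ z ∂(volume.restrict (cyl T Ω)), u z.1 z.2 ∈ Icc 0 M)
    (hv : ∀ᵐ z ∂(volume.restrict (cyl T Ω)), v z.1 z.2 ∈ Icc 0 M) (r : ℝ) (q : ℝ≥0∞) :
    MemLp (fun z : ℝ × Eucl N => quotientTest r ε (u z.1 z.2, v z.1 z.2)) q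
      (volume.restrict (cyl T Ω)) := by
  have := isFiniteMeasure_restrict_cyl hΩ T
  have hc : ContinuousOn (quotientTest r ε) (Icc 0 M ×ˢ Icc 0 M) := fun z hz =>
    (hasFDerivAt_quotientTest hε hz.1.1 hz.2.1).continuousAt.continuousWithinAt
  obtain ⟨C, -, hC⟩ := exists_abs_le_of_continuousOn hc
  refine MemLp.of_bound (aestronglyMeasurable_comp_of_continuousOn hM hum hvm hu hv hc) C ?_
  filter_upwards [hu, hv] with z h1 h2
  exact hC _ h1 _ h2

/-- The singular term is integrable against the solution itself. -/
theorem integrableOn_singular_mul_self {g u : ℝ → Eucl N → ℝ} (hm₀ : 0 ≤ m)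
    (hg : IntegrableOn (fun z : ℝ × Eucl N => g z.1 z.2) (cyl T Ω))
    (hum : AEStronglyMeasurable (fun z : ℝ × Eucl N => u z.1 z.2) (volume.restrict (cyl T Ω)))
    (hu : ∀ᵐ z ∂(volume.restrict (cyl T Ω)), u z.1 z.2 ∈ Icc 0 M)
    (hS : IntegrableOn (sourceTerm m δ γ Ω g u u) (cyl T Ω)) :
    IntegrableOn (fun z : ℝ × Eucl N => m * bdist Ω z.2 ^ (-γ) * u z.1 z.2 ^ δ * u z.1 z.2)
      (cyl T Ω) := by
  have hgu : IntegrableOn (fun z : ℝ × Eucl N => g z.1 z.2 * (u z.1 z.2 ^ m * u z.1 z.2))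
      (cyl T Ω) := by
    refine Integrable.mul_bdd (c := M ^ m * M) hg
      (((Real.continuous_rpow_const hm₀).comp_aestronglyMeasurable hum).mul hum) ?_
    filter_upwards [hu] with z h1
    have h0 := h1.1
    have h2 : u z.1 z.2 ^ m ≤ M ^ m := Real.rpow_le_rpow h1.1 h1.2 hm₀
    rw [Real.norm_of_nonneg (by positivity)]
    exact mul_le_mul h2 h1.2 h0 (Real.rpow_nonneg (h0.trans h1.2) m)
  refine (hS.sub hgu).congr (Eventually.of_forall fun z => ?_)
  simp only [Pi.sub_apply, sourceTerm]
  ring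

theorem integral_weakTimeDeriv_sub_mul_nonpos {w y : ℝ → Eucl N → ℝ} {G K : ℝ → Eucl N → Eucl N}
    (hp : 1 < p) (hm₀ : 0 ≤ m) (hm₁ : m < p - 1) (hδ : 0 < m → δ ≤ m)
    (hΩo : IsOpen Ω) (hΩ : Bornology.IsBounded Ω)
    {g u v : ℝ → Eucl N → ℝ} (hM : 0 ≤ M)
    (hg : IntegrableOn (fun z : ℝ × Eucl N => g z.1 z.2) (cyl T Ω))
    (hw : IntegrableOn (fun z : ℝ × Eucl N => w z.1 z.2) (cyl T Ω))
    (hy : IntegrableOn (fun z : ℝ × Eucl N => y z.1 z.2) (cyl T Ω))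
    (huB : MemBochnerW0 ⊤ p T Ω u G) (hvB : MemBochnerW0 ⊤ p T Ω v K)
    (hu : ∀ᵐ z ∂(volume.restrict (cyl T Ω)), u z.1 z.2 ∈ Icc 0 M)
    (hv : ∀ᵐ z ∂(volume.restrict (cyl T Ω)), v z.1 z.2 ∈ Icc 0 M)
    (hupos : ∀ᵐ z ∂(volume.restrict (cyl T Ω)), 0 < u z.1 z.2)
    (hvpos : ∀ᵐ z ∂(volume.restrict (cyl T Ω)), 0 < v z.1 z.2)
    (huE : ∀ (φ : ℝ → Eucl N → ℝ) (H : ℝ → Eucl N → Eucl N),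
      MemLp (fun z : ℝ × Eucl N => φ z.1 z.2) 2 (volume.restrict (cyl T Ω)) →
      MemBochnerW0 1 p T Ω φ H →
      IntegrableOn (timeTerm m u w φ) (cyl T Ω) ∧
      IntegrableOn (localTerm p G H) (cyl T Ω) ∧
      IntegrableOn (nonlocalTerm p s u φ) (Ioo 0 T ×ˢ univ) ∧
      IntegrableOn (sourceTerm m δ γ Ω g u φ) (cyl T Ω) ∧
      ∀ t ∈ Ioc 0 T,
        (∫ z in cyl t Ω, timeTerm m u w φ z) + (∫ z in cyl t Ω, localTerm p G H z)
          + (∫ z in Ioo 0 t ×ˢ univ, nonlocalTerm p s u φ z)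
          = ∫ z in cyl t Ω, sourceTerm m δ γ Ω g u φ z)
    (hvE : ∀ (φ : ℝ → Eucl N → ℝ) (H : ℝ → Eucl N → Eucl N),
      MemLp (fun z : ℝ × Eucl N => φ z.1 z.2) 2 (volume.restrict (cyl T Ω)) →
      MemBochnerW0 1 p T Ω φ H →
      IntegrableOn (timeTerm m v y φ) (cyl T Ω) ∧
      IntegrableOn (localTerm p K H) (cyl T Ω) ∧
      IntegrableOn (nonlocalTerm p s v φ) (Ioo 0 T ×ˢ univ) ∧
      IntegrableOn (sourceTerm m δ γ Ω g v φ) (cyl T Ω) ∧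
      ∀ t ∈ Ioc 0 T,
        (∫ z in cyl t Ω, timeTerm m v y φ z) + (∫ z in cyl t Ω, localTerm p K H z)
          + (∫ z in Ioo 0 t ×ˢ univ, nonlocalTerm p s v φ z)
          = ∫ z in cyl t Ω, sourceTerm m δ γ Ω g v φ z)
    {t : ℝ} (ht : t ∈ Ioc 0 T) :
    ∫ z in cyl t Ω, (w z.1 z.2 - y z.1 z.2) *
      (u z.1 z.2 ^ (m + 1) - v z.1 z.2 ^ (m + 1)) ≤ 0 := by
  have := isFiniteMeasure_restrict_cyl hΩ T
  have hum := huB.meas.mono_measure (Measure.restrict_mono (cyl_subset_univ T Ω) le_rfl)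
  have hvm := hvB.meas.mono_measure (Measure.restrict_mono (cyl_subset_univ T Ω) le_rfl)
  -- Through the extension by zero the bounds hold on all of space, as the nonlocal terms require.
  have hu' := huB.ae_mem_Icc hΩo.measurableSet hM hu
  have hv' := hvB.ae_mem_Icc hΩo.measurableSet hM hv
  have hu2 : MemLp (fun z : ℝ × Eucl N => u z.1 z.2) 2 (volume.restrict (cyl T Ω)) :=
    MemLp.of_bound hum M (hu.mono fun z h => by rw [Real.norm_of_nonneg h.1]; exact h.2)
  have hv2 : MemLp (fun z : ℝ × Eucl N => v z.1 z.2) 2 (volume.restrict (cyl T Ω)) :=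
    MemLp.of_bound hvm M (hv.mono fun z h => by rw [Real.norm_of_nonneg h.1]; exact h.2)
  -- Each solution is an admissible test function in its own equation; this supplies the majorant of
  -- the singular terms.
  have hdu := integrableOn_singular_mul_self hm₀ hg hum hu (huE u G hu2 huB.to_one).2.2.2.1
  have hdv := integrableOn_singular_mul_self hm₀ hg hvm hv (hvE v K hv2 hvB.to_one).2.2.2.1
  have hε : ∀ n : ℕ, (0 : ℝ) < 1 / ((n : ℝ) + 1) := fun n => by positivity
  have U := fun n : ℕ => huE _ _
    (memLp_quotientTest hΩ hM (hε n) hum hvm hu hv (m + 1) 2)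
    (huB.comp₂ hM hp.le hΩo.measurableSet hΩ hvB hu' hv'
      (fun z hz => hasFDerivAt_quotientTest (r := m + 1) (hε n) hz.1.1 hz.2.1)
      (continuousOn_quotientTestFst (hε n)) (continuousOn_quotientTestSnd (hε n))
      (quotientTest_zero (hε n)))
  have V := fun n : ℕ => hvE _ _
    (memLp_quotientTest hΩ hM (hε n) hvm hum hv hu (m + 1) 2)
    (hvB.comp₂ hM hp.le hΩo.measurableSet hΩ huB hv' hu'
      (fun z hz => hasFDerivAt_quotientTest (r := m + 1) (hε n) hz.1.1 hz.2.1)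
      (continuousOn_quotientTestFst (hε n)) (continuousOn_quotientTestSnd (hε n))
      (quotientTest_zero (hε n)))
  have hsub := cyl_subset_cyl ht.2 Ω
  refine integral_weakTimeDeriv_mul_le_zero (d := fun z => bdist Ω z.2 ^ (-γ))
    (g := fun z => g z.1 z.2) (u := fun z => u z.1 z.2) (v := fun z => v z.1 z.2)
    (w := fun z => w z.1 z.2) (y := fun z => y z.1 z.2) (M := M) hm₀ hδ
    (fun z => Real.rpow_nonneg Metric.infDist_nonneg _)
    (ae_restrict_of_ae_restrict_of_subset hsub hu) (ae_restrict_of_ae_restrict_of_subset hsub hv)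
    (ae_restrict_of_ae_restrict_of_subset hsub hupos)
    (ae_restrict_of_ae_restrict_of_subset hsub hvpos)
    (hum.mono_measure (Measure.restrict_mono hsub le_rfl))
    (hvm.mono_measure (Measure.restrict_mono hsub le_rfl))
    (hg.mono_set hsub) (hw.mono_set hsub) (hy.mono_set hsub) (hdu.mono_set hsub)
    (hdv.mono_set hsub) (fun n => (U n).2.2.2.1.mono_set hsub)
    (fun n => (V n).2.2.2.1.mono_set hsub) (fun n => (U n).1.mono_set hsub)
    (fun n => (V n).1.mono_set hsub) fun n => ?_
  exact integral_time_add_le_integral_source_add hp hm₀ hm₁ (hε n) ht.2 hu' hv' rfl rfl rfl rfl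
    (U n).2.1 (V n).2.1 (U n).2.2.1 (V n).2.2.1 ((U n).2.2.2.2 t ht) ((V n).2.2.2.2 t ht)

end Uniqueness

/-! ### Conclusion -/

theorem mainTheorem11 {N : ℕ} (p s m δ γ T : ℝ) (Ω : Set (Eucl N))
    (hp : 1 < p) (hpN : p < N) (hs₀ : 0 < s) (hs₁ : s < 1) (hm₀ : 0 ≤ m) (hm₁ : m < p - 1)
    (hδγ : 0 < m → 0 < δ ∧ δ < m ∧ ∃ b : ℝ, (N : ℝ) < b ∧ 2 * m - 1 < 2 * δ - b * γ)
    (hT : 0 < T) (hΩ : IsSmoothBoundedDomain Ω)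
    (g : ℝ → Eucl N → ℝ)
    (hg : MemLp (fun z : ℝ × Eucl N => g z.1 z.2) 2 (volume.restrict (cyl T Ω)))
    (u₀ : Eucl N → ℝ) (hu₀ : ∀ᵐ x ∂(volume.restrict Ω), 0 ≤ u₀ x)
    (hu₀' : MemLp u₀ (ENNReal.ofReal (2 * (m + 1))) (volume.restrict Ω))
    (u v : ℝ → Eucl N → ℝ)
    (hu : IsWeakSolution p s m δ γ T Ω g u₀ u) (hv : IsWeakSolution p s m δ γ T Ω g u₀ v) :
    ∀ᵐ z ∂(volume.restrict (cyl T Ω)), u z.1 z.2 = v z.1 z.2 := by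
  obtain ⟨G, w, huB, huL, hupos, hwL, hwD, hui, huE⟩ := hu
  obtain ⟨K, y, hvB, hvL, hvpos, hyL, hyD, hvi, hvE⟩ := hv
  have hΩo := hΩ.isOpen
  have hΩb := hΩ.isBounded
  have := isFiniteMeasure_restrict_cyl hΩb T
  have hr : 0 ≤ m + 1 := by linarith
  have hpow := Real.continuous_rpow_const hr
  obtain ⟨M, hM, hu, hv⟩ := exists_ae_mem_Icc huL hvL hupos hvpos
  have hwi := hwL.integrable (by norm_num)
  have hyi := hyL.integrable (by norm_num)
  have hbound : ∀ {f : ℝ × Eucl N → ℝ}, (∀ᵐ z ∂(volume.restrict (cyl T Ω)), f z ∈ Icc 0 M) →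
      ∀ᵐ z ∂(volume.restrict (cyl T Ω)), ‖f z ^ (m + 1)‖ ≤ M ^ (m + 1) := fun hf => by
    filter_upwards [hf] with z h
    rw [Real.norm_of_nonneg (Real.rpow_nonneg h.1 _)]
    exact Real.rpow_le_rpow h.1 h.2 hr
  have hur : IntegrableOn (fun z : ℝ × Eucl N => u z.1 z.2 ^ (m + 1)) (cyl T Ω) :=
    Integrable.of_bound (hpow.comp_aestronglyMeasurable huL.aestronglyMeasurable) _ (hbound hu)
  have hvr : IntegrableOn (fun z : ℝ × Eucl N => v z.1 z.2 ^ (m + 1)) (cyl T Ω) :=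
    Integrable.of_bound (hpow.comp_aestronglyMeasurable hvL.aestronglyMeasurable) _ (hbound hv)
  have hslice : ∀ {f : ℝ → Eucl N → ℝ} {F : ℝ → Eucl N → Eucl N}, MemBochnerW0 ⊤ p T Ω f F →
      ∀ᵐ t ∂(volume.restrict (Ioo 0 T)),
        AEStronglyMeasurable (fun x => f t x ^ (m + 1)) (volume.restrict Ω) := fun hf =>
    hf.slice.mono fun t h => hpow.comp_aestronglyMeasurable h.memLp.aestronglyMeasurable.restrict
  -- The energy argument is applied to u^(m+1) - v^(m+1), whose initial value is zero because u₀ is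
  -- common to both solutions.
  have hzero := ae_eq_zero_of_integral_mul_weakTimeDeriv_nonpos hT
    (hwD.sub hyD hur hvr hwi hyi) hΩo (hur.sub hvr) (hwi.sub hyi)
    (Integrable.mul_bdd (c := M ^ (m + 1) + M ^ (m + 1)) (hwi.sub hyi)
      (hur.sub hvr).aestronglyMeasurable (by
        filter_upwards [hbound hu, hbound hv] with z h1 h2
        exact (norm_sub_le _ _).trans (add_le_add h1 h2)))
    (fun ε hε => hui.lintegral_sub_le hT hΩb hvi (hslice huB) (hslice hvB)
      (hpow.comp_aestronglyMeasurable hu₀'.aestronglyMeasurable) hε)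
    (fun t ht => integral_weakTimeDeriv_sub_mul_nonpos hp hm₀ hm₁ (fun h => (hδγ h).2.1.le) hΩo hΩb hM
      (hg.integrable (by norm_num)) hwi hyi huB hvB hu hv hupos hvpos huE hvE ht)
  filter_upwards [hzero, hupos, hvpos] with z h1 h2 h3
  exact Real.rpow_left_injOn (by linarith : m + 1 ≠ 0) h2.le h3.le (sub_eq_zero.1 h1)
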